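/- Let $(G,+)$ be a locally compact (Hausdorff) abelian group and let $H$ be a subgroup of the dual group $\hat G$. Equip $H$ with a (locally compact, Hausdorff) topology which makes it a locally compact group (not necessarily the subspace topology), and fix Haar measures on $G$ and $H$. Assume that $$\delta_h(f) = [g \mapsto h(g) f(g)] \quad (h \in H,\ f \in C_c(G)), \qquad \varepsilon_g(\tilde f) = [h \mapsto h(-g) \tilde f(h)] \quad (g \in G,\ \tilde f \in C_c(H))$$ map $C_c(G)$ into $C_c(G)$ and $C_c(H)$ into $C_c(H)$, and extend to strongly continuous actions $\delta$ of $H$ on the group C*-algebra $C^*(G)$ and $\varepsilon$ of $G$ on $C^*(H)$, respectively. Here, for a strongly continuous action $\alpha$ of a locally compact abelian group $S$ on a C*-algebra $A$, the (full) crossed product $A \rtimes_\alpha S$ is the completion of $C_c(S,A)$, with product $(f_1 * f_2)(s) = \int_S f_1(r)\, \alpha_r(f_2(r^{-1}s))\, dr$ and involution $f^*(s) = \alpha_s(f(s^{-1})^*)$, in the norm $\|f\| = \sup_\pi \|\pi(f)\|$, where $\pi$ runs through the nondegenerate *-representations of $L^1(S,A)$ on Hilbert spaces; $C^*(S) = \mathbb{C}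 \rtimes S$ for the trivial action. A function $f \in C_c(G \times H)$ is viewed as the element $h \mapsto f(\cdot,h) \in C_c(G) \to C^*(G)$ of $C^*(G) \rtimes_\delta H$, and similarly $C_c(H \times G)$ is mapped to $C^*(H) \rtimes_\varepsilon G$. Then $$\varphi : C_c(G \times H) \to C_c(H \times G), \qquad f \mapsto [(h,g) \mapsto h(-g) f(g,h)]$$ is well defined and extends to a *-isomorphism $C^*(G) \rtimes_\delta H \cong C^*(H) \rtimes_\varepsilon G$. -/

import Mathlib

open MeasureTheory Topology
open scoped CompactlySupported

set_option linter.unusedSectionVars false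

universe u v

noncomputable section

/-- A strongly continuous action of a topological group `G` on a C⋆-algebra `A` by
⋆-automorphisms. -/
structure CStarAction (G : Type u) (A : Type v) [Group G] [TopologicalSpace G]
    [NonUnitalCStarAlgebra A] where
  toHom : G →* (A ≃⋆ₐ[ℂ] A)
  continuous_apply : ∀ a : A, Continuous fun g => toHom g a

namespace CStarAction

variable {G : Type u} {A : Type v} [Group G] [TopologicalSpace G] [NonUnitalCStarAlgebra A]

instance : CoeFun (CStarAction G A) fun _ => G → (A ≃⋆ₐ[ℂ] A) := ⟨fun α => α.toHom⟩

/-- The trivial action. -/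
def trivial (G : Type u) (A : Type v) [Group G] [TopologicalSpace G]
    [NonUnitalCStarAlgebra A] : CStarAction G A where
  toHom := 1
  continuous_apply _ := continuous_const

variable (α : CStarAction G A)

theorem mul_apply (g h : G) (a : A) : α (g * h) a = α g (α h a) := by
  rw [map_mul]; rfl

theorem norm_apply (g : G) (a : A) : ‖α g a‖ = ‖a‖ := by
  apply le_antisymm (NonUnitalStarAlgHom.norm_apply_le (α g) a)
  have h := NonUnitalStarAlgHom.norm_apply_le (α g).symm (α g a)
  simpa using h

theorem continuous_uncurry : Continuous fun p : G × A => α p.1 p.2 := by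
  rw [continuous_iff_continuousAt]
  rintro ⟨g, a⟩
  rw [ContinuousAt, tendsto_iff_norm_sub_tendsto_zero]
  have h1 : Filter.Tendsto (fun p : G × A => ‖p.2 - a‖ + ‖α p.1 a - α g a‖) (𝓝 (g, a)) (𝓝 0) := by
    have : Continuous fun p : G × A => ‖p.2 - a‖ + ‖α p.1 a - α g a‖ := by
      have := (α.continuous_apply a).comp (continuous_fst (X := G) (Y := A))
      simp only [Function.comp_def] at this
      fun_prop
    simpa using this.tendsto (g, a)
  refine squeeze_zero (fun _ => norm_nonneg _) (fun p => ?_) h1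
  have : α p.1 p.2 - α g a = α p.1 (p.2 - a) + (α p.1 a - α g a) := by
    rw [map_sub]; abel
  rw [this]
  refine (norm_add_le _ _).trans ?_
  rw [α.norm_apply]

theorem continuous_comp {X : Type*} [TopologicalSpace X] {s : X → G} {a : X → A}
    (hs : Continuous s) (ha : Continuous a) : Continuous fun x => α (s x) (a x) :=
  α.continuous_uncurry.comp (hs.prodMk ha)

/-- The automorphism `α g` as a continuous linear map. -/
def toCLM (g : G) : A →L[ℂ] A :=
  LinearMap.mkContinuous
    { toFun := α g, map_add' := map_add (α g), map_smul' := map_smul (α g) } 1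
    (fun a => by simpa using (α.norm_apply g a).le)

theorem toCLM_apply (g : G) (a : A) : α.toCLM g a = α g a := rfl

end CStarAction

/-- A (possibly neither Hausdorff nor complete) normed ⋆-algebra whose seminorm satisfies the
C⋆-identity. -/
class PreCStarAlgebra (E : Type*) extends NonUnitalSeminormedRing E, StarRing E,
    NormedSpace ℂ E, IsScalarTower ℂ E E, SMulCommClass ℂ E E, StarModule ℂ E where
  norm_mul_self_le : ∀ x : E, ‖x‖ * ‖x‖ ≤ ‖star x * x‖

theorem PreCStarAlgebra.norm_star_le {E : Type*} [PreCStarAlgebra E] (x : E) :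
    ‖star x‖ ≤ ‖x‖ := by
  rcases (norm_nonneg (star x)).eq_or_lt with h | h
  · rw [← h]; exact norm_nonneg x
  · have h1 := (norm_mul_self_le (star x)).trans (norm_mul_le _ _)
    rw [star_star] at h1
    exact le_of_mul_le_mul_right h1 h

/-- The C⋆-algebra obtained by (Hausdorff) completion. -/
def CStarCompletion (E : Type u) [PreCStarAlgebra E] : Type u := UniformSpace.Completion E

namespace CStarCompletion

variable (E : Type u) [PreCStarAlgebra E]

open UniformSpace UniformSpace.Completion

instance : NormedAddCommGroup (CStarCompletion E) :=
  inferInstanceAs (NormedAddCommGroup (Completion (E)))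
instance : NormedSpace ℂ (CStarCompletion E) :=
  inferInstanceAs (NormedSpace ℂ (Completion (E)))
instance : CompleteSpace (CStarCompletion E) :=
  inferInstanceAs (CompleteSpace (Completion (E)))

variable {E}

/-- The canonical map from the algebra to its completion. -/
def incl (f : E) : CStarCompletion E := ((f : Completion (E)))

theorem norm_incl (f : E) : ‖incl f‖ = ‖f‖ := Completion.norm_coe f
theorem incl_add (f g : E) : incl (f + g) = incl f + incl g := Completion.coe_add f g
theorem incl_zero : incl (0 : E) = 0 := rfl
theorem incl_smul (c : ℂ) (f : E) : incl (c • f) = c • incl f := Completion.coe_smul c f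
theorem incl_sub (f g : E) : incl (f - g) = incl f - incl g := Completion.coe_sub f g
theorem continuous_incl : Continuous (incl : E → CStarCompletion E) :=
  Completion.continuous_coe _
theorem isDenseInducing_incl : IsDenseInducing (incl : E → CStarCompletion E) :=
  Completion.isDenseInducing_coe

theorem induction_on {p : CStarCompletion E → Prop} (a : CStarCompletion E)
    (hp : IsClosed {a | p a}) (ih : ∀ f : E, p (incl f)) : p a :=
  Completion.induction_on a hp ih

/-- The multiplication extends the product by continuity. -/
instance : Mul (CStarCompletion E) where
  mul a b := (isDenseInducing_incl.prodMap isDenseInducing_incl).extend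
    (fun p : E × E => incl (p.1 * p.2)) (a, b)

theorem incl_mul (f g : E) : incl (f * g) = incl f * incl g :=
  ((isDenseInducing_incl.prodMap isDenseInducing_incl).extend_eq
    (f := fun p : E × E => incl (p.1 * p.2))
    (continuous_incl.comp continuous_mul) (f, g)).symm

instance : ContinuousMul (CStarCompletion E) where
  continuous_mul := by
    let i : E →+ CStarCompletion E := ⟨⟨incl, incl_zero⟩, incl_add⟩
    let m := (AddMonoidHom.mul : E →+ E →+ E).compr₂ i
    have : Continuous fun p : E × E => m p.1 p.2 :=
      continuous_incl.comp continuous_mul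
    have di : IsDenseInducing i := isDenseInducing_incl
    exact (di.extend_Z_bilin di this :)

/-- The involution extends the involution of the algebra by continuity. -/
instance : Star (CStarCompletion E) where
  star := Completion.map (star : E → E)

theorem uniformContinuous_convStar :
    UniformContinuous (star : E → E) :=
  haveI : NormedStarGroup E := ⟨PreCStarAlgebra.norm_star_le⟩
  (star_isometry (E := E)).uniformContinuous

theorem incl_star (f : E) : incl (star f) = star (incl f) :=
  (Completion.map_coe uniformContinuous_convStar f).symm

instance : ContinuousStar (CStarCompletion E) where
  continuous_star := Completion.continuous_map

theorem cp_mul_assoc (a b c : CStarCompletion E) : a * b * c = a * (b * c) := by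
  induction a using induction_on with
  | hp => exact isClosed_eq
            (Continuous.mul (Continuous.mul continuous_id continuous_const) continuous_const)
            (Continuous.mul continuous_id continuous_const)
  | ih a =>
  induction b using induction_on with
  | hp => exact isClosed_eq
            (Continuous.mul (Continuous.mul continuous_const continuous_id) continuous_const)
            (Continuous.mul continuous_const (Continuous.mul continuous_id continuous_const))
  | ih b =>
  induction c using induction_on with
  | hp => exact isClosed_eq
            (Continuous.mul continuous_const continuous_id)
            (Continuous.mul continuous_const (Continuous.mul continuous_const continuous_id))
  | ih c =>
  simp only [← incl_mul, mul_assoc]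

theorem cp_mul_add (a b c : CStarCompletion E) : a * (b + c) = a * b + a * c := by
  induction a using induction_on with
  | hp => exact isClosed_eq
            (Continuous.mul continuous_id continuous_const)
            (Continuous.add (Continuous.mul continuous_id continuous_const) (Continuous.mul continuous_id continuous_const))
  | ih a =>
  induction b using induction_on with
  | hp => exact isClosed_eq
            (Continuous.mul continuous_const (Continuous.add continuous_id continuous_const))
            (Continuous.add (Continuous.mul continuous_const continuous_id) continuous_const)
  | ih b =>
  induction c using induction_on with
  | hp => exact isClosed_eq
            (Continuous.mul continuous_const (Continuous.add continuous_const continuous_id))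
            (Continuous.add continuous_const (Continuous.mul continuous_const continuous_id))
  | ih c =>
  simp only [← incl_mul, ← incl_add, mul_add]

theorem cp_add_mul (a b c : CStarCompletion E) : (a + b) * c = a * c + b * c := by
  induction a using induction_on with
  | hp => exact isClosed_eq
            (Continuous.mul (Continuous.add continuous_id continuous_const) continuous_const)
            (Continuous.add (Continuous.mul continuous_id continuous_const) continuous_const)
  | ih a =>
  induction b using induction_on with
  | hp => exact isClosed_eq
            (Continuous.mul (Continuous.add continuous_const continuous_id) continuous_const)
            (Continuous.add continuous_const (Continuous.mul continuous_id continuous_const))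
  | ih b =>
  induction c using induction_on with
  | hp => exact isClosed_eq
            (Continuous.mul continuous_const continuous_id)
            (Continuous.add (Continuous.mul continuous_const continuous_id) (Continuous.mul continuous_const continuous_id))
  | ih c =>
  simp only [← incl_mul, ← incl_add, add_mul]

theorem cp_zero_mul (a : CStarCompletion E) : 0 * a = 0 := by
  induction a using induction_on with
  | hp => exact isClosed_eq
            (Continuous.mul continuous_const continuous_id)
            (continuous_const)
  | ih a =>
  rw [← incl_zero, ← incl_mul, zero_mul]

theorem cp_mul_zero (a : CStarCompletion E) : a * 0 = 0 := by
  induction a using induction_on with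
  | hp => exact isClosed_eq
            (Continuous.mul continuous_id continuous_const)
            (continuous_const)
  | ih a =>
  rw [← incl_zero, ← incl_mul, mul_zero]

theorem cp_norm_mul_le (a b : CStarCompletion E) : ‖a * b‖ ≤ ‖a‖ * ‖b‖ := by
  induction a using induction_on with
  | hp => exact isClosed_le
            (Continuous.norm (Continuous.mul continuous_id continuous_const))
            (Continuous.mul (Continuous.norm continuous_id) continuous_const)
  | ih a =>
  induction b using induction_on with
  | hp => exact isClosed_le
            (Continuous.norm (Continuous.mul continuous_const continuous_id))
            (Continuous.mul continuous_const (Continuous.norm continuous_id))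
  | ih b =>
  simpa only [← incl_mul, norm_incl] using norm_mul_le a b

theorem cp_star_star (a : CStarCompletion E) : star (star a) = a := by
  induction a using induction_on with
  | hp => exact isClosed_eq
            (Continuous.star (Continuous.star continuous_id))
            (continuous_id)
  | ih a =>
  simp only [← incl_star, star_star]

theorem cp_star_mul (a b : CStarCompletion E) : star (a * b) = star b * star a := by
  induction a using induction_on with
  | hp => exact isClosed_eq
            (Continuous.star (Continuous.mul continuous_id continuous_const))
            (Continuous.mul continuous_const (Continuous.star continuous_id))
  | ih a =>
  induction b using induction_on with
  | hp => exact isClosed_eq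
            (Continuous.star (Continuous.mul continuous_const continuous_id))
            (Continuous.mul (Continuous.star continuous_id) continuous_const)
  | ih b =>
  simp only [← incl_mul, ← incl_star, star_mul]

theorem cp_star_add (a b : CStarCompletion E) : star (a + b) = star a + star b := by
  induction a using induction_on with
  | hp => exact isClosed_eq
            (Continuous.star (Continuous.add continuous_id continuous_const))
            (Continuous.add (Continuous.star continuous_id) continuous_const)
  | ih a =>
  induction b using induction_on with
  | hp => exact isClosed_eq
            (Continuous.star (Continuous.add continuous_const continuous_id))
            (Continuous.add continuous_const (Continuous.star continuous_id))
  | ih b =>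
  simp only [← incl_add, ← incl_star, star_add]

theorem cp_norm_sq_le (a : CStarCompletion E) : ‖a‖ * ‖a‖ ≤ ‖star a * a‖ := by
  induction a using induction_on with
  | hp => exact isClosed_le
            (Continuous.mul (Continuous.norm continuous_id) (Continuous.norm continuous_id))
            (Continuous.norm (Continuous.mul (Continuous.star continuous_id) continuous_id))
  | ih a =>
  simpa only [← incl_mul, ← incl_star, norm_incl] using PreCStarAlgebra.norm_mul_self_le a

theorem cp_smul_mul (c : ℂ) (a b : CStarCompletion E) : c • a * b = c • (a * b) := by
  induction a using induction_on with
  | hp => exact isClosed_eq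
            (Continuous.mul (Continuous.const_smul continuous_id c) continuous_const)
            (Continuous.const_smul (Continuous.mul continuous_id continuous_const) c)
  | ih a =>
  induction b using induction_on with
  | hp => exact isClosed_eq
            (Continuous.mul continuous_const continuous_id)
            (Continuous.const_smul (Continuous.mul continuous_const continuous_id) c)
  | ih b =>
  simp only [← incl_mul, ← incl_smul, smul_mul_assoc]

theorem cp_mul_smul (c : ℂ) (a b : CStarCompletion E) : a * c • b = c • (a * b) := by
  induction a using induction_on with
  | hp => exact isClosed_eq
            (Continuous.mul continuous_id continuous_const)
            (Continuous.const_smul (Continuous.mul continuous_id continuous_const) c)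
  | ih a =>
  induction b using induction_on with
  | hp => exact isClosed_eq
            (Continuous.mul continuous_const (Continuous.const_smul continuous_id c))
            (Continuous.const_smul (Continuous.mul continuous_const continuous_id) c)
  | ih b =>
  simp only [← incl_mul, ← incl_smul, mul_smul_comm]

theorem cp_star_smul (c : ℂ) (a : CStarCompletion E) : star (c • a) = star c • star a := by
  induction a using induction_on with
  | hp => exact isClosed_eq
            (Continuous.star (Continuous.const_smul continuous_id c))
            (Continuous.const_smul (Continuous.star continuous_id) (star c))
  | ih a =>
  simp only [← incl_star, ← incl_smul, star_smul]

instance : NonUnitalRing (CStarCompletion E) where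
  mul_assoc := cp_mul_assoc
  left_distrib := cp_mul_add
  right_distrib := cp_add_mul
  zero_mul := cp_zero_mul
  mul_zero := cp_mul_zero

/-- The completion is a C⋆-algebra. -/
instance : NonUnitalCStarAlgebra (CStarCompletion E) where
  __ := (inferInstance : NormedAddCommGroup (CStarCompletion E))
  __ := (inferInstance : NonUnitalRing (CStarCompletion E))
  __ := (inferInstance : NormedSpace ℂ (CStarCompletion E))
  __ := (inferInstance : CompleteSpace (CStarCompletion E))
  norm_mul_le := cp_norm_mul_le
  star_involutive := cp_star_star
  star_mul := cp_star_mul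
  star_add := cp_star_add
  norm_mul_self_le := cp_norm_sq_le
  smul_assoc := cp_smul_mul
  smul_comm c a b := (cp_mul_smul c a b).symm
  star_smul := cp_star_smul

end CStarCompletion

/-- The space `C_c(G, A)`, to be equipped with the twisted convolution product and involution
determined by the action `α` and the measure `μ`. -/
def ConvAlg {G : Type u} {A : Type v} [Group G] [TopologicalSpace G] [NonUnitalCStarAlgebra A]
    [MeasurableSpace G] (_α : CStarAction G A) (_μ : Measure G) : Type (max u v) :=
  C_c(G, A)

namespace ConvAlg

section Linear

variable {G : Type u} {A : Type v} [Group G] [TopologicalSpace G] [NonUnitalCStarAlgebra A]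
  [MeasurableSpace G] (α : CStarAction G A) (μ : Measure G)

instance : AddCommGroup (ConvAlg α μ) := inferInstanceAs (AddCommGroup C_c(G, A))
instance : Module ℂ (ConvAlg α μ) := inferInstanceAs (Module ℂ C_c(G, A))
instance : FunLike (ConvAlg α μ) G A := inferInstanceAs (FunLike C_c(G, A) G A)

variable {α μ}

/-- A compactly supported continuous function, as an element of the convolution algebra. -/
def of (f : C_c(G, A)) : ConvAlg α μ := f

@[simp] theorem of_apply (f : C_c(G, A)) (s : G) : (of f : ConvAlg α μ) s = f s := rfl

@[ext] theorem ext {f g : ConvAlg α μ} (h : ∀ s, f s = g s) : f = g := DFunLike.ext _ _ h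

@[simp] theorem add_apply (f g : ConvAlg α μ) (s : G) : (f + g) s = f s + g s := rfl
@[simp] theorem sub_apply (f g : ConvAlg α μ) (s : G) : (f - g) s = f s - g s := rfl
@[simp] theorem zero_apply (s : G) : (0 : ConvAlg α μ) s = 0 := rfl
@[simp] theorem smul_apply (c : ℂ) (f : ConvAlg α μ) (s : G) : (c • f) s = c • f s := rfl

theorem continuous (f : ConvAlg α μ) : Continuous f :=
  map_continuous (F := C_c(G, A)) f

theorem hasCompactSupport (f : ConvAlg α μ) : HasCompactSupport f :=
  CompactlySupportedContinuousMap.hasCompactSupport (β := A) f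

/-- The `L¹`-norm `∫ ‖f s‖ dμ(s)`. -/
def l1norm (f : ConvAlg α μ) : ℝ := ∫ s, ‖f s‖ ∂μ

end Linear

variable {G : Type u} {A : Type v} [CommGroup G] [TopologicalSpace G] [IsTopologicalGroup G]
  [MeasurableSpace G] [BorelSpace G] [NonUnitalCStarAlgebra A]
  {α : CStarAction G A} {μ : Measure G} [μ.IsHaarMeasure]

theorem conv_continuous₂ (f g : ConvAlg α μ) :
    Continuous fun p : G × G => f p.2 * α p.2 (g (p.2⁻¹ * p.1)) := by
  have hf := f.continuous
  have hg := g.continuous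
  exact (hf.comp continuous_snd).mul
    (α.continuous_comp continuous_snd (hg.comp (by fun_prop)))

theorem conv_continuous (f g : ConvAlg α μ) :
    Continuous fun s => ∫ r, f r * α r (g (r⁻¹ * s)) ∂μ := by
  rw [← continuousOn_univ]
  refine continuousOn_integral_of_compact_support (k := tsupport f) f.hasCompactSupport
    ((conv_continuous₂ f g).continuousOn) ?_
  intro s r _ hr
  rw [image_eq_zero_of_notMem_tsupport hr, zero_mul]

theorem conv_hasCompactSupport (f g : ConvAlg α μ) :
    HasCompactSupport fun s => ∫ r, f r * α r (g (r⁻¹ * s)) ∂μ := by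
  refine HasCompactSupport.intro
    (IsCompact.mul f.hasCompactSupport g.hasCompactSupport) (fun s hs => ?_)
  refine (integral_congr_ae (Filter.Eventually.of_forall fun r => ?_)).trans (integral_zero G A)
  by_cases hr : r ∈ tsupport f
  · have : r⁻¹ * s ∉ tsupport g := fun h => hs ⟨r, hr, r⁻¹ * s, h, by simp⟩
    simp [image_eq_zero_of_notMem_tsupport this]
  · simp [image_eq_zero_of_notMem_tsupport hr]

theorem conv_integrable (f g : ConvAlg α μ) (s : G) :
    Integrable (fun r => f r * α r (g (r⁻¹ * s))) μ := by
  refine Continuous.integrable_of_hasCompactSupport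
    ((conv_continuous₂ f g).comp (Continuous.prodMk_right s)) ?_
  exact HasCompactSupport.intro f.hasCompactSupport fun r hr => by
    simp [image_eq_zero_of_notMem_tsupport hr]

/-- The convolution product `(f * g)(s) = ∫ f(r) α_r(g(r⁻¹ s)) dμ(r)`. -/
instance : Mul (ConvAlg α μ) where
  mul f g := of ⟨⟨fun s => ∫ r, f r * α r (g (r⁻¹ * s)) ∂μ, conv_continuous f g⟩,
    conv_hasCompactSupport f g⟩

theorem mul_apply (f g : ConvAlg α μ) (s : G) :
    (f * g) s = ∫ r, f r * α r (g (r⁻¹ * s)) ∂μ := rfl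

/-- The involution `f⋆(s) = α_s(f(s⁻¹)⋆)`; abelian groups are unimodular, so that there is no
modular function. -/
instance : Star (ConvAlg α μ) where
  star f := of ⟨⟨fun s => α s (star (f s⁻¹)), by
      have hf := f.continuous
      exact α.continuous_comp continuous_id (by fun_prop)⟩, by
    refine HasCompactSupport.intro (IsCompact.inv f.hasCompactSupport) (fun s hs => ?_)
    have : s⁻¹ ∉ tsupport f := by simpa using hs
    simp [image_eq_zero_of_notMem_tsupport this]⟩

theorem star_apply (f : ConvAlg α μ) (s : G) : (star f) s = α s (star (f s⁻¹)) := rfl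

theorem conv_assoc (f g k : ConvAlg α μ) : f * g * k = f * (g * k) := by
  ext s
  have h1 : ∀ r, (f * g) r * α r (k (r⁻¹ * s))
      = ∫ t, f t * α t (g (t⁻¹ * r)) * α r (k (r⁻¹ * s)) ∂μ := fun r =>
    (((ContinuousLinearMap.mul ℂ A).flip (α r (k (r⁻¹ * s)))).integral_comp_comm
      (conv_integrable f g r)).symm
  have h2 : ∀ t, f t * α t ((g * k) (t⁻¹ * s))
      = ∫ r, f t * α t (g (t⁻¹ * r)) * α r (k (r⁻¹ * s)) ∂μ := fun t => by
    have := ((ContinuousLinearMap.mul ℂ A (f t)).comp (α.toCLM t)).integral_comp_comm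
      (conv_integrable g k (t⁻¹ * s))
    rw [← integral_mul_left_eq_self _ t⁻¹] at this
    refine this.symm.trans ?_
    congr 1
    ext r
    simp only [ContinuousLinearMap.comp_apply, CStarAction.toCLM_apply,
      ContinuousLinearMap.mul_apply', map_mul (α t), mul_assoc]
    rw [← α.mul_apply]
    simp
  rw [mul_apply, mul_apply]
  simp only [h1, h2]
  refine integral_integral_swap_of_hasCompactSupport (f := fun r t =>
    f t * α t (g (t⁻¹ * r)) * α r (k (r⁻¹ * s))) ?_ ?_
  · have hf := f.continuous
    have hg := g.continuous
    have hk := k.continuous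
    exact ((hf.comp continuous_snd).mul
      (α.continuous_comp continuous_snd (hg.comp (by fun_prop)))).mul
      (α.continuous_comp continuous_fst (hk.comp (by fun_prop)))
  · refine HasCompactSupport.intro
      ((IsCompact.mul f.hasCompactSupport g.hasCompactSupport).prod f.hasCompactSupport) ?_
    rintro ⟨r, t⟩ hrt
    by_cases ht : t ∈ tsupport f
    · have : t⁻¹ * r ∉ tsupport g := fun h => hrt ⟨⟨t, ht, t⁻¹ * r, h, by simp⟩, ht⟩
      simp [Function.uncurry, image_eq_zero_of_notMem_tsupport this]
    · simp [Function.uncurry, image_eq_zero_of_notMem_tsupport ht]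

instance : NonUnitalRing (ConvAlg α μ) where
  mul_assoc := conv_assoc
  left_distrib f g k := by
    ext s
    simp only [mul_apply, add_apply, map_add, mul_add]
    exact integral_add (conv_integrable f g s) (conv_integrable f k s)
  right_distrib f g k := by
    ext s
    simp only [mul_apply, add_apply, add_mul]
    exact integral_add (conv_integrable f k s) (conv_integrable g k s)
  zero_mul f := by ext s; simp [mul_apply]
  mul_zero f := by ext s; simp [mul_apply]

instance : IsScalarTower ℂ (ConvAlg α μ) (ConvAlg α μ) where
  smul_assoc c f g := by
    ext s
    simp only [smul_eq_mul, mul_apply, smul_apply, smul_mul_assoc]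
    exact integral_smul c _

instance : SMulCommClass ℂ (ConvAlg α μ) (ConvAlg α μ) where
  smul_comm c f g := by
    ext s
    simp only [smul_eq_mul, mul_apply, smul_apply, map_smul, mul_smul_comm]
    exact (integral_smul c _).symm

theorem apply_star_integral (s : G) {f : G → A} (hf : Integrable f μ) :
    α s (star (∫ r, f r ∂μ)) = ∫ r, α s (star (f r)) ∂μ :=
  ((((α.toCLM s).restrictScalars ℝ).comp
    ((starL' ℝ : A ≃L[ℝ] A) : A →L[ℝ] A)).integral_comp_comm hf).symm

instance : StarRing (ConvAlg α μ) where
  star_involutive f := by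
    ext s
    simp only [star_apply, ← map_star, star_star, inv_inv]
    rw [← α.mul_apply]
    simp
  star_add f g := by ext s; simp [star_apply]
  star_mul f g := by
    ext s
    rw [star_apply, mul_apply, mul_apply, apply_star_integral s (conv_integrable f g s⁻¹)]
    rw [← integral_mul_left_eq_self _ s⁻¹]
    congr 1
    ext r
    simp only [star_apply, star_mul, map_mul (α s), mul_inv_rev, inv_inv, ← map_star,
      ← α.mul_apply, mul_inv_cancel_left, mul_inv_cancel_right]

instance : StarModule ℂ (ConvAlg α μ) where
  star_smul c f := by ext s; simp [star_apply]

end ConvAlg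

section Universal

variable {G : Type u} {A : Type v} [CommGroup G] [TopologicalSpace G] [IsTopologicalGroup G]
  [MeasurableSpace G] [BorelSpace G] [NonUnitalCStarAlgebra A]
  (α : CStarAction G A) (μ : Measure G) [μ.IsHaarMeasure]

/-- A nondegenerate ⋆-representation of `C_c(G, A)` on a Hilbert space which is contractive for the
`L¹`-norm, i.e. (the restriction to the dense subalgebra `C_c(G, A)` of) a nondegenerate
⋆-representation of the Banach ⋆-algebra `L¹(G, A)`. -/
structure L1Rep (K : Type*) [NormedAddCommGroup K] [InnerProductSpace ℂ K] [CompleteSpace K] where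
  toHom : ConvAlg α μ →⋆ₙₐ[ℂ] (K →L[ℂ] K)
  norm_le : ∀ f, ‖toHom f‖ ≤ f.l1norm
  nondegenerate : (Submodule.span ℂ {y : K | ∃ f x, toHom f x = y}).topologicalClosure = ⊤

namespace ConvAlg

variable {α μ}

/-- The norms `‖π(f)‖`, where `π` runs through the nondegenerate representations of `L¹(G, A)`. -/
def repNorms (f : ConvAlg α μ) : Set ℝ :=
  {r | ∃ (K : Type (max u v)) (_ : NormedAddCommGroup K) (_ : InnerProductSpace ℂ K)
    (_ : CompleteSpace K) (π : L1Rep α μ K), ‖π.toHom f‖ = r}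

theorem repNorms_bddAbove (f : ConvAlg α μ) : BddAbove f.repNorms := by
  refine ⟨f.l1norm, ?_⟩
  rintro r ⟨K, _, _, _, π, rfl⟩
  exact π.norm_le f

/-- The universal norm `sup ‖π(f)‖`, where `π` runs through the nondegenerate
representations of `L¹(G, A)`. -/
def univNorm (f : ConvAlg α μ) : ℝ := sSup f.repNorms

theorem rep_le_univNorm (f : ConvAlg α μ) {K : Type (max u v)} [NormedAddCommGroup K]
    [InnerProductSpace ℂ K] [CompleteSpace K] (π : L1Rep α μ K) : ‖π.toHom f‖ ≤ f.univNorm :=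
  le_csSup f.repNorms_bddAbove ⟨K, _, _, _, π, rfl⟩

theorem univNorm_nonneg (f : ConvAlg α μ) : 0 ≤ f.univNorm :=
  Real.sSup_nonneg (by rintro r ⟨K, _, _, _, π, rfl⟩; exact norm_nonneg _)

theorem l1norm_nonneg (f : ConvAlg α μ) : 0 ≤ f.l1norm :=
  integral_nonneg fun _ => norm_nonneg _

theorem univNorm_le_of_rep {f : ConvAlg α μ} {c : ℝ} (hc : 0 ≤ c)
    (h : ∀ (K : Type (max u v)) [NormedAddCommGroup K] [InnerProductSpace ℂ K]
      [CompleteSpace K] (π : L1Rep α μ K), ‖π.toHom f‖ ≤ c) : f.univNorm ≤ c :=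
  Real.sSup_le (by rintro r ⟨K, _, _, _, π, rfl⟩; exact h K π) hc

theorem univNorm_le_l1norm (f : ConvAlg α μ) : f.univNorm ≤ f.l1norm :=
  univNorm_le_of_rep f.l1norm_nonneg fun _ _ _ _ π => π.norm_le f

theorem univNorm_zero : (0 : ConvAlg α μ).univNorm = 0 :=
  le_antisymm (univNorm_le_of_rep le_rfl fun _ _ _ _ π => by simp) (univNorm_nonneg _)

theorem univNorm_add_le (f g : ConvAlg α μ) : (f + g).univNorm ≤ f.univNorm + g.univNorm :=
  univNorm_le_of_rep (add_nonneg f.univNorm_nonneg g.univNorm_nonneg) fun _ _ _ _ π => by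
    rw [map_add]
    exact (norm_add_le _ _).trans (add_le_add (rep_le_univNorm f π) (rep_le_univNorm g π))

theorem univNorm_neg (f : ConvAlg α μ) : (-f).univNorm = f.univNorm := by
  simp [univNorm, repNorms]

theorem univNorm_smul_le (c : ℂ) (f : ConvAlg α μ) : (c • f).univNorm ≤ ‖c‖ * f.univNorm :=
  univNorm_le_of_rep (mul_nonneg (norm_nonneg c) f.univNorm_nonneg) fun _ _ _ _ π => by
    rw [map_smul, norm_smul]
    exact mul_le_mul_of_nonneg_left (rep_le_univNorm f π) (norm_nonneg c)

theorem univNorm_mul_le (f g : ConvAlg α μ) : (f * g).univNorm ≤ f.univNorm * g.univNorm :=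
  univNorm_le_of_rep (mul_nonneg f.univNorm_nonneg g.univNorm_nonneg) fun _ _ _ _ π => by
    rw [map_mul]
    exact (norm_mul_le _ _).trans (mul_le_mul (rep_le_univNorm f π) (rep_le_univNorm g π)
      (norm_nonneg _) f.univNorm_nonneg)

theorem univNorm_sq_le (f : ConvAlg α μ) :
    f.univNorm * f.univNorm ≤ (star f * f).univNorm := by
  have h : f.univNorm ≤ Real.sqrt (star f * f).univNorm :=
    univNorm_le_of_rep (Real.sqrt_nonneg _) fun _ _ _ _ π => by
      apply Real.le_sqrt_of_sq_le
      rw [sq, ← CStarRing.norm_star_mul_self, ← map_star, ← map_mul]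
      exact rep_le_univNorm _ π
  calc f.univNorm * f.univNorm
      ≤ Real.sqrt (star f * f).univNorm * Real.sqrt (star f * f).univNorm :=
        mul_self_le_mul_self f.univNorm_nonneg h
    _ = _ := Real.mul_self_sqrt (univNorm_nonneg _)

/-- `C_c(G, A)` with the universal norm. -/
instance : PreCStarAlgebra (ConvAlg α μ) where
  __ := (inferInstance : NonUnitalRing (ConvAlg α μ))
  __ := (inferInstance : Module ℂ (ConvAlg α μ))
  __ := (inferInstance : StarRing (ConvAlg α μ))
  __ := AddGroupSeminorm.toSeminormedAddCommGroup (E := ConvAlg α μ)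
    { toFun := univNorm, map_zero' := univNorm_zero, add_le' := univNorm_add_le,
      neg' := univNorm_neg }
  norm_mul_le := univNorm_mul_le
  norm_smul_le := univNorm_smul_le
  smul_assoc c f g := smul_assoc c f g
  smul_comm c f g := smul_comm c f g
  star_smul c f := star_smul c f
  norm_mul_self_le := univNorm_sq_le

theorem norm_eq_univNorm (f : ConvAlg α μ) : ‖f‖ = f.univNorm := rfl

end ConvAlg

/-- The (full) crossed product `A ⋊_α G`: the (Hausdorff) completion of `C_c(G, A)` in the
universal norm. -/
abbrev CrossedProduct : Type (max u v) := CStarCompletion (ConvAlg α μ)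


end Universal

section GroupAlgebra

variable {G : Type u} [CommGroup G] [TopologicalSpace G] [IsTopologicalGroup G]
  [MeasurableSpace G] [BorelSpace G] (μ : Measure G) [μ.IsHaarMeasure]

/-- The group C⋆-algebra `C⋆(G)`: the crossed product of `ℂ` by the trivial action, i.e. the
enveloping C⋆-algebra of `L¹(G)`. -/
abbrev GroupCStar : Type u := CrossedProduct (CStarAction.trivial G ℂ) μ

/-- The canonical map `C_c(G) → C⋆(G)`. -/
def GroupCStar.of (f : C_c(G, ℂ)) : GroupCStar μ := CStarCompletion.incl (ConvAlg.of f)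

end GroupAlgebra

section TwoVariables

variable {G H : Type u} [CommGroup G] [TopologicalSpace G] [IsTopologicalGroup G]
  [MeasurableSpace G] [BorelSpace G] {μ : Measure G} [μ.IsHaarMeasure]
  [CommGroup H] [TopologicalSpace H] [IsTopologicalGroup H]
  [MeasurableSpace H] [BorelSpace H]

/-- The function `f(·, h)` of the first variable. -/
def sliceLeft (f : C_c(G × H, ℂ)) (h : H) : C_c(G, ℂ) :=
  ⟨⟨fun g => f (g, h), (map_continuous f).comp (Continuous.prodMk_left h)⟩, by
    refine HasCompactSupport.intro (f.hasCompactSupport.isCompact.image continuous_fst)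
      (fun g hg => ?_)
    exact image_eq_zero_of_notMem_tsupport (f := f) fun hmem => hg ⟨(g, h), hmem, rfl⟩⟩

theorem continuous_sliceLeft (f : C_c(G × H, ℂ)) :
    Continuous fun h => GroupCStar.of μ (sliceLeft f h) := by
  rw [continuous_iff_continuousAt]
  intro h₀
  rw [ContinuousAt, tendsto_iff_norm_sub_tendsto_zero]
  have hf : Continuous f := map_continuous f
  have hc : Continuous fun h => ∫ g, ‖f (g, h) - f (g, h₀)‖ ∂μ := by
    rw [← continuousOn_univ]
    refine continuousOn_integral_of_compact_support (k := Prod.fst '' tsupport f)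
      (f.hasCompactSupport.isCompact.image continuous_fst) ?_ ?_
    · exact Continuous.continuousOn (by unfold Function.uncurry; fun_prop)
    · intro h g _ hg
      have key : ∀ k, f (g, k) = 0 := fun k =>
        image_eq_zero_of_notMem_tsupport fun hmem => hg ⟨(g, k), hmem, rfl⟩
      simp [key]
  have h0 := hc.tendsto h₀
  simp only [sub_self, norm_zero, integral_zero] at h0
  refine squeeze_zero (fun _ => norm_nonneg _) (fun h => ?_) h0
  unfold GroupCStar.of
  rw [← CStarCompletion.incl_sub, CStarCompletion.norm_incl]
  exact ConvAlg.univNorm_le_l1norm _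

/-- The canonical map `C_c(G × H) → C⋆(G) ⋊_δ H`, sending `f` to the class of
`h ↦ f(·, h) ∈ C_c(G) → C⋆(G)`. -/
def CrossedProduct.ofProd (δ : CStarAction H (GroupCStar μ)) (ν : Measure H) [ν.IsHaarMeasure]
    (f : C_c(G × H, ℂ)) : CrossedProduct δ ν :=
  CStarCompletion.incl <| ConvAlg.of
    ⟨⟨fun h => GroupCStar.of μ (sliceLeft f h), continuous_sliceLeft f⟩, by
      refine HasCompactSupport.intro (f.hasCompactSupport.isCompact.image continuous_snd)
        (fun h hh => ?_)
      have : sliceLeft f h = 0 := by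
        ext g
        exact image_eq_zero_of_notMem_tsupport (f := f) fun hmem => hh ⟨(g, h), hmem, rfl⟩
      change GroupCStar.of μ (sliceLeft f h) = 0
      rw [this]
      rfl⟩

end TwoVariables

end

/-! Write `β h g` for the value of the character `h` at `g`. A nondegenerate representation of
`C⋆(H) ⋊ G` amounts to unitary representations `W` of `H` and `U` of `G` on one Hilbert space with
the Weyl relation `W_h U_g = β(h, g) U_g W_h`. Up to replacing `β(h, g)` by `β(h, g⁻¹)`, this
relation is symmetric in `G` and `H`, so the same pair also gives a representation of `C⋆(G) ⋊ H`.
On functions of two variables the two integrated forms are `∬ f'(h, g) W_h U_g` and `∬ f(g, h) U_g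
W_h`; by Fubini and the Weyl relation they coincide exactly when `f'(h, g) = β(h, g⁻¹) f(g, h)`,
which is the twist (`L1Rep.dual_toHom_ofProd`).

The norms are suprema over representations, so the twist does not increase them (`norm_ofProd_le`).
The inverse twist is the twist for the opposite pairing, whence equality (`norm_ofProd_twist`).
Functions of two variables are dense in both crossed products (`CrossedProduct.denseRange_ofProd`),
and the twist extends to a linear isometry onto. Composed with any representation of the target,
this isometry is again a representation of the source (`lift_twistIsometry`); since representations
separate points, it respects products and adjoints, and no two-variable convolution has to be
computed.

Three analytic facts support this. The unitaries are recovered from a representation as multipliers: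
a linear map `m` with `(m f)⋆ (m g) = f⋆ g` induces an isometry `π(f) x ↦ π(m f) x`
(`L1Rep.unitaryOf`). Maps bounded in the `L¹`-norm commute with integrals of compactly supported
continuous families (`ConvAlg.map_integral_of_l1norm_bound`). Finally, the twist preserves
continuity only if `β` is jointly continuous, and this follows from strong continuity of `δ`
(`continuous_pairing`). -/

noncomputable section

/-! ### Extension of ⋆-homomorphisms to the completion. -/

namespace CStarCompletion

variable {E : Type u} [PreCStarAlgebra E] {B : Type*} [NonUnitalCStarAlgebra B]

theorem denseRange_incl : DenseRange (incl : E → CStarCompletion E) :=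
  isDenseInducing_incl.dense

/-- The canonical map to the completion, as a linear map. -/
def inclₗ : E →ₗ[ℂ] CStarCompletion E where
  toFun := incl
  map_add' := incl_add
  map_smul' := incl_smul

/-- The extension of a contractive ⋆-homomorphism to the completion. -/
def lift (T : E →⋆ₙₐ[ℂ] B) (hT : ∀ f, ‖T f‖ ≤ ‖f‖) : CStarCompletion E →⋆ₙₐ[ℂ] B :=
  let L : CStarCompletion E →L[ℂ] B := ((T : E →ₗ[ℂ] B)).extendOfNorm (inclₗ : E →ₗ[ℂ] _)
  have hL : ∀ f, L (incl f) = T f := fun f =>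
    LinearMap.extendOfNorm_eq (e := inclₗ) denseRange_incl
      ⟨1, fun x => by rw [one_mul]; exact (hT x).trans (norm_incl x).ge⟩ f
  { toFun := L
    map_smul' := map_smul L
    map_zero' := map_zero L
    map_add' := map_add L
    map_mul' := fun a b => by
      induction a using induction_on with
      | hp => exact isClosed_eq (L.continuous.comp (continuous_id.mul continuous_const))
                (L.continuous.mul continuous_const)
      | ih a =>
      induction b using induction_on with
      | hp => exact isClosed_eq (L.continuous.comp (continuous_const.mul continuous_id))
                (continuous_const.mul L.continuous)
      | ih b => rw [← incl_mul, hL, hL, hL, map_mul]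
    map_star' := fun a => by
      induction a using induction_on with
      | hp => exact isClosed_eq (L.continuous.comp continuous_star) L.continuous.star
      | ih a => rw [← incl_star, hL, hL, map_star] }

theorem lift_incl (T : E →⋆ₙₐ[ℂ] B) (hT : ∀ f, ‖T f‖ ≤ ‖f‖) (f : E) :
    lift T hT (incl f) = T f :=
  LinearMap.extendOfNorm_eq (e := inclₗ) denseRange_incl
    ⟨1, fun x => by rw [one_mul]; exact (hT x).trans (norm_incl x).ge⟩ f

end CStarCompletion

theorem NonUnitalStarAlgHom.continuous_of_cstar {A B : Type*} [NonUnitalCStarAlgebra A]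
    [NonUnitalCStarAlgebra B] (T : A →⋆ₙₐ[ℂ] B) : Continuous T :=
  AddMonoidHomClass.continuous_of_bound T 1 fun a => by
    simpa using NonUnitalStarAlgHom.norm_apply_le T a

/-! ### Testing continuous functions against compactly supported ones. -/

section Vanishing

variable {G : Type*} [Group G] [TopologicalSpace G] [IsTopologicalGroup G]
  [LocallyCompactSpace G] [MeasurableSpace G] [BorelSpace G] (μ : Measure G) [μ.IsHaarMeasure]

theorem exists_bump (x : G) : ∃ b : C_c(G, ℝ), b x = 1 ∧ ∀ y, 0 ≤ b y := by
  obtain ⟨b, hb1, -, hb, hb0⟩ := exists_continuous_one_zero_of_isCompact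
    (isCompact_singleton (x := x)) isClosed_empty (Set.disjoint_empty _)
  exact ⟨⟨b, hb⟩, hb1 (Set.mem_singleton x), fun y => (hb0 y).1⟩

/-- A continuous function is determined by its integrals against compactly supported ones. -/
theorem eq_zero_of_forall_integral_smul_eq_zero {X : Type*} [NormedAddCommGroup X]
    [NormedSpace ℂ X] [CompleteSpace X] {k : G → X} (hk : Continuous k)
    (h : ∀ b : C_c(G, ℂ), ∫ s, b s • k s ∂μ = 0) (x : G) : k x = 0 := by
  by_contra hx
  obtain ⟨l, hl⟩ := SeparatingDual.exists_ne_zero (R := ℂ) hx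
  obtain ⟨b, hb1, hb0⟩ := exists_bump x
  have hlk : Continuous fun s => l (k s) := l.continuous.comp hk
  have hbc : Continuous b := map_continuous b
  -- The conjugate of `l ∘ k` makes the integral of `c · (l ∘ k)` equal to that of `b |l ∘ k|²`,
  -- which is strictly positive because the integrand is positive at `x`.
  let c : C_c(G, ℂ) := ⟨⟨fun s => (b s : ℂ) * star (l (k s)), by fun_prop⟩,
    HasCompactSupport.intro b.hasCompactSupport fun s hs => by
      simp [image_eq_zero_of_notMem_tsupport hs]⟩
  have hcs : HasCompactSupport fun s => b s * ‖l (k s)‖ ^ 2 :=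
    HasCompactSupport.intro b.hasCompactSupport fun s hs => by
      simp [image_eq_zero_of_notMem_tsupport hs]
  have hpos : 0 < ∫ s, b s * ‖l (k s)‖ ^ 2 ∂μ := by
    refine Continuous.integral_pos_of_hasCompactSupport_nonneg_nonzero (x := x) (by fun_prop) hcs
      (fun s => mul_nonneg (hb0 s) (sq_nonneg _)) ?_
    simpa [hb1] using hl
  have hint : Integrable (fun s => c s • k s) μ := by
    refine Continuous.integrable_of_hasCompactSupport ((map_continuous c).smul hk) ?_
    exact HasCompactSupport.intro c.hasCompactSupport fun s hs => by
      simp [image_eq_zero_of_notMem_tsupport hs]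
  have h0 := l.integral_comp_comm hint
  rw [h c, map_zero] at h0
  have : ∀ s, l (c s • k s) = ((b s * ‖l (k s)‖ ^ 2 : ℝ) : ℂ) := fun s => by
    rw [map_smul]
    change (b s : ℂ) * star (l (k s)) * l (k s) = _
    rw [mul_assoc, mul_comm (star _), Complex.star_def, Complex.mul_conj, Complex.normSq_eq_norm_sq]
    push_cast
    rfl
  simp only [this] at h0
  rw [integral_complex_ofReal, Complex.ofReal_eq_zero] at h0
  exact hpos.ne' h0

end Vanishing

/-! ### Linear maps bounded in the `L¹`-norm: continuity and integrals. -/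

namespace ConvAlg

variable {G : Type u} {A : Type v} [CommGroup G] [TopologicalSpace G] [IsTopologicalGroup G]
  [MeasurableSpace G] [BorelSpace G] [NonUnitalCStarAlgebra A]
  {α : CStarAction G A} {μ : Measure G} [μ.IsHaarMeasure]
  {X : Type*} [NormedAddCommGroup X] [NormedSpace ℂ X]

/-- A compact set containing the supports of all nearby members turns joint continuity of the family
into continuity in the `L¹`-norm. Only local uniformity of the support is needed, so the parameter
space may be noncompact. -/
theorem continuous_of_l1norm_bound (T : ConvAlg α μ →ₗ[ℂ] X) {C : ℝ}
    (hT : ∀ f, ‖T f‖ ≤ C * f.l1norm) {Y : Type*} [TopologicalSpace Y] (Θ : Y → ConvAlg α μ)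
    (hΘ : Continuous fun p : Y × G => Θ p.1 p.2)
    (hs : ∀ y₀, ∃ N ∈ 𝓝 y₀, ∃ D, IsCompact D ∧ ∀ y ∈ N, ∀ t ∉ D, Θ y t = 0) :
    Continuous fun y => T (Θ y) := by
  rw [continuous_iff_continuousAt]
  intro y₀
  obtain ⟨N, hN, D, hD, hND⟩ := hs y₀
  rw [ContinuousAt, tendsto_iff_norm_sub_tendsto_zero]
  have hc : ContinuousOn (fun y => ∫ t, ‖Θ y t - Θ y₀ t‖ ∂μ) N := by
    refine continuousOn_integral_of_compact_support hD ?_ ?_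
    · have h2 : Continuous fun p : Y × G => Θ y₀ p.2 := (Θ y₀).continuous.comp continuous_snd
      exact (hΘ.sub h2).norm.continuousOn
    · intro y t hy ht
      simp [hND y hy t ht, hND y₀ (mem_of_mem_nhds hN) t ht]
  have h0 := (hc.continuousAt hN).tendsto.const_mul C
  simp only [sub_self, norm_zero, integral_zero, mul_zero] at h0
  refine squeeze_zero (fun _ => norm_nonneg _) (fun y => ?_) h0
  rw [← map_sub]
  exact hT _

variable (A) in
/-- Bounded continuous functions vanishing off a given set. -/
def boundedOn (D : Set G) : Submodule ℂ (BoundedContinuousFunction G A) where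
  carrier := {f | ∀ t ∉ D, f t = 0}
  add_mem' hf hg t ht := by simp [hf t ht, hg t ht]
  zero_mem' _ _ := rfl
  smul_mem' c f hf t ht := by simp [hf t ht]

/-- Closedness yields completeness, so that Bochner integrals can be formed in this space. -/
theorem isClosed_boundedOn (D : Set G) :
    IsClosed (boundedOn A D : Set (BoundedContinuousFunction G A)) := by
  have : (boundedOn A D : Set (BoundedContinuousFunction G A)) =
      ⋂ t ∈ Dᶜ, {f : BoundedContinuousFunction G A | f t = 0} := by
    ext f
    simp only [Set.mem_iInter]
    exact Iff.rfl
  rw [this]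
  exact isClosed_biInter fun t _ => isClosed_eq
    (BoundedContinuousFunction.evalCLM ℂ t : _ →L[ℂ] A).continuous continuous_const

instance (D : Set G) : CompleteSpace (boundedOn A D) :=
  (isClosed_boundedOn D).completeSpace_coe

/-- An `L¹`-bounded linear map commutes with integrals of compactly supported jointly continuous
families. -/
theorem map_integral_of_l1norm_bound [CompleteSpace X] (T : ConvAlg α μ →ₗ[ℂ] X) {C : ℝ}
    (hC : 0 ≤ C) (hT : ∀ f, ‖T f‖ ≤ C * f.l1norm)
    {Y : Type*} [TopologicalSpace Y] [R1Space Y] [MeasurableSpace Y] [OpensMeasurableSpace Y]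
    (ρ : Measure Y) [IsFiniteMeasureOnCompacts ρ] (Θ : Y → ConvAlg α μ) (F : ConvAlg α μ)
    (hΘ : Continuous fun p : Y × G => Θ p.1 p.2) {K : Set Y} {D : Set G} (hK : IsCompact K)
    (hD : IsCompact D) (hΘK : ∀ y ∉ K, ∀ t, Θ y t = 0) (hΘD : ∀ y, ∀ t ∉ D, Θ y t = 0)
    (hF : ∀ t, F t = ∫ y, Θ y t ∂ρ) : T F = ∫ y, T (Θ y) ∂ρ := by
  -- The convolution algebra is not complete, so the integral is taken in the Banach space of
  -- bounded continuous functions supported in the fixed compact set `D`.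
  let emb : boundedOn A D →ₗ[ℂ] ConvAlg α μ :=
    { toFun f := of ⟨⟨f, f.1.continuous⟩, HasCompactSupport.intro hD f.2⟩
      map_add' _ _ := rfl
      map_smul' _ _ := rfl }
  have hemb : ∀ (f : boundedOn A D) (t : G), emb f t = f.1 t := fun _ _ => rfl
  -- On functions supported in `D` the `L¹`-norm is at most `μ(D)` times the sup norm, which gives
  -- the constant.
  let L : boundedOn A D →L[ℂ] X := (T.comp emb).mkContinuous (C * μ.real D) fun f => by
    refine (hT _).trans ?_
    rw [mul_assoc]
    refine mul_le_mul_of_nonneg_left ?_ hC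
    have h1 : ∫ t in D, ‖f.1 t‖ ∂μ = ∫ t, ‖f.1 t‖ ∂μ :=
      setIntegral_eq_integral_of_forall_compl_eq_zero fun t ht => by simp [f.2 t ht]
    have h2 := norm_setIntegral_le_of_norm_le_const (μ := μ) (f := fun t => ‖f.1 t‖) (C := ‖f‖)
      hD.measure_lt_top (fun t _ => by simpa using f.1.norm_coe_le_norm t)
    rw [h1] at h2
    rw [mul_comm]
    exact (le_abs_self _).trans h2
  have hbd : ∀ y, ∃ c, ∀ s t, dist (Θ y s) (Θ y t) ≤ c := fun y => by
    obtain ⟨c, hc⟩ := (Θ y).hasCompactSupport.exists_bound_of_continuous (Θ y).continuous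
    exact ⟨c + c, fun s t => (dist_le_norm_add_norm _ _).trans (add_le_add (hc s) (hc t))⟩
  let Ψ : Y → boundedOn A D := fun y =>
    ⟨⟨⟨Θ y, (Θ y).continuous⟩, hbd y⟩, hΘD y⟩
  have hΨ : ∀ y t, (Ψ y).1 t = Θ y t := fun _ _ => rfl
  -- Compactness of `D` upgrades joint continuity to uniform closeness on `D`; off `D` all members
  -- vanish.
  have hΨc : Continuous Ψ := by
    rw [continuous_iff_continuousAt]
    intro y₀
    rw [ContinuousAt, Metric.tendsto_nhds]
    intro e he
    have h3 : ∀ᶠ y in 𝓝 y₀, ∀ t ∈ D, dist (Θ y t) (Θ y₀ t) < e / 2 := by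
      refine hD.eventually_forall_of_forall_eventually
        (P := fun y t => dist (Θ y t) (Θ y₀ t) < e / 2) fun t _ => ?_
      have h4 : Continuous fun p : Y × G => dist (Θ p.1 p.2) (Θ y₀ p.2) :=
        hΘ.dist ((Θ y₀).continuous.comp continuous_snd)
      exact h4.continuousAt.eventually_lt continuousAt_const (by simpa using half_pos he)
    filter_upwards [h3] with y hy
    refine lt_of_le_of_lt ?_ (half_lt_self he)
    change dist (Ψ y).1 (Ψ y₀).1 ≤ _
    rw [BoundedContinuousFunction.dist_le (half_pos he).le]
    intro t
    rw [hΨ, hΨ]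
    by_cases ht : t ∈ D
    · exact (hy t ht).le
    · rw [hΘD y t ht, hΘD y₀ t ht, dist_self]
      exact (half_pos he).le
  have hΨi : Integrable Ψ ρ := hΨc.integrable_of_hasCompactSupport
    (HasCompactSupport.intro hK fun y hy => by
      apply Subtype.ext
      ext t
      exact hΘK y hy t)
  have hLΨ : ∀ y, L (Ψ y) = T (Θ y) := fun y => rfl
  simp only [← hLΨ]
  rw [L.integral_comp_comm hΨi]
  change T F = T (emb _)
  congr 1
  ext t
  rw [hemb, hF]
  -- Evaluation at `t` is continuous in the sup norm, so the Bochner integral of the family is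
  -- computed pointwise and equals `F`.
  let ev : boundedOn A D →L[ℂ] A :=
    (BoundedContinuousFunction.evalCLM ℂ t).comp (boundedOn A D).subtypeL
  exact ev.integral_comp_comm hΨi

end ConvAlg

end
-- Unitary and covariant representations and their integrated forms.
noncomputable section

/-- A strongly continuous unitary representation of a topological group. -/
structure UnitaryRep (G : Type*) (K : Type*) [Group G] [TopologicalSpace G]
    [NormedAddCommGroup K] [InnerProductSpace ℂ K] where
  toHom : G →* (K →L[ℂ] K)
  norm_map : ∀ g x, ‖toHom g x‖ = ‖x‖
  continuous_apply : ∀ x, Continuous fun g => toHom g x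

namespace UnitaryRep

variable {G K : Type*} [Group G] [TopologicalSpace G] [NormedAddCommGroup K]
  [InnerProductSpace ℂ K]

instance : CoeFun (UnitaryRep G K) fun _ => G → K →L[ℂ] K := ⟨fun W => W.toHom⟩

variable (W : UnitaryRep G K)

theorem mul_apply (g h : G) (x : K) : W (g * h) x = W g (W h x) := by
  rw [map_mul]; rfl

theorem one_apply (x : K) : W 1 x = x := by
  rw [map_one]; rfl

theorem inner_map_map (g : G) (x y : K) : inner ℂ (W g x) (W g y) = inner ℂ x y :=
  LinearIsometry.inner_map_map (⟨(W g : K →ₗ[ℂ] K), W.norm_map g⟩ : K →ₗᵢ[ℂ] K) x y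

theorem inner_map_left (g : G) (x y : K) : inner ℂ (W g x) y = inner ℂ x (W g⁻¹ y) := by
  rw [← W.inner_map_map g x, ← W.mul_apply, mul_inv_cancel, W.one_apply]

theorem continuous_uncurry : Continuous fun p : G × K => W p.1 p.2 := by
  rw [continuous_iff_continuousAt]
  rintro ⟨g, a⟩
  rw [ContinuousAt, tendsto_iff_norm_sub_tendsto_zero]
  have h1 : Filter.Tendsto (fun p : G × K => ‖p.2 - a‖ + ‖W p.1 a - W g a‖) (𝓝 (g, a)) (𝓝 0) := by
    have : Continuous fun p : G × K => ‖p.2 - a‖ + ‖W p.1 a - W g a‖ := by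
      have := (W.continuous_apply a).comp (continuous_fst (X := G) (Y := K))
      simp only [Function.comp_def] at this
      fun_prop
    simpa using this.tendsto (g, a)
  refine squeeze_zero (fun _ => norm_nonneg _) (fun p => ?_) h1
  have : W p.1 p.2 - W g a = W p.1 (p.2 - a) + (W p.1 a - W g a) := by
    rw [map_sub]; abel
  rw [this]
  refine (norm_add_le _ _).trans ?_
  rw [W.norm_map]

theorem continuous_comp {X : Type*} [TopologicalSpace X] {s : X → G} {a : X → K}
    (hs : Continuous s) (ha : Continuous a) : Continuous fun x => W (s x) (a x) :=
  W.continuous_uncurry.comp (hs.prodMk ha)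

/-- The trivial representation. -/
def trivial (G K : Type*) [Group G] [TopologicalSpace G] [NormedAddCommGroup K]
    [InnerProductSpace ℂ K] : UnitaryRep G K where
  toHom := 1
  norm_map _ _ := rfl
  continuous_apply _ := continuous_const

theorem trivial_apply (g : G) (x : K) : UnitaryRep.trivial G K g x = x := rfl

end UnitaryRep

/-- A covariant representation of an action on a C⋆-algebra. -/
structure CovariantRep {G : Type*} {A : Type*} [Group G] [TopologicalSpace G]
    [NonUnitalCStarAlgebra A] (α : CStarAction G A) (K : Type*) [NormedAddCommGroup K]
    [InnerProductSpace ℂ K] [CompleteSpace K] where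
  rep : A →⋆ₙₐ[ℂ] (K →L[ℂ] K)
  unitary : UnitaryRep G K
  covariant : ∀ g a x, rep (α g a) (unitary g x) = unitary g (rep a x)
  nondegenerate : (Submodule.span ℂ {y : K | ∃ a x, rep a x = y}).topologicalClosure = ⊤

namespace CovariantRep

variable {G : Type u} {A : Type v} [CommGroup G] [TopologicalSpace G] [IsTopologicalGroup G]
  [MeasurableSpace G] [BorelSpace G] [NonUnitalCStarAlgebra A]
  {α : CStarAction G A} {μ : Measure G} [μ.IsHaarMeasure]
  {K : Type*} [NormedAddCommGroup K] [InnerProductSpace ℂ K] [CompleteSpace K]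
  (R : CovariantRep α K)

theorem norm_rep_apply_le (a : A) (x : K) : ‖R.rep a x‖ ≤ ‖a‖ * ‖x‖ :=
  ((R.rep a).le_opNorm x).trans
    (mul_le_mul_of_nonneg_right (NonUnitalStarAlgHom.norm_apply_le R.rep a) (norm_nonneg x))

theorem continuous_rep_comp {Y : Type*} [TopologicalSpace Y] {a : Y → A} {x : Y → K}
    (ha : Continuous a) (hx : Continuous x) : Continuous fun y => R.rep (a y) (x y) :=
  (R.rep.continuous_of_cstar.comp ha).clm_apply hx

theorem continuous_integrand (f : ConvAlg α μ) (x : K) :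
    Continuous fun s => R.rep (f s) (R.unitary s x) :=
  R.continuous_rep_comp f.continuous (R.unitary.continuous_apply x)

theorem integrable_integrand (f : ConvAlg α μ) (x : K) :
    Integrable (fun s => R.rep (f s) (R.unitary s x)) μ :=
  (R.continuous_integrand f x).integrable_of_hasCompactSupport
    (HasCompactSupport.intro f.hasCompactSupport fun s hs => by
      simp [image_eq_zero_of_notMem_tsupport hs])

theorem norm_integral_le (f : ConvAlg α μ) (x : K) :
    ‖∫ s, R.rep (f s) (R.unitary s x) ∂μ‖ ≤ f.l1norm * ‖x‖ := by
  refine (norm_integral_le_integral_norm _).trans ?_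
  rw [ConvAlg.l1norm, ← integral_mul_const]
  refine integral_mono (R.integrable_integrand f x).norm ?_ fun s => ?_
  · exact ((f.continuous.integrable_of_hasCompactSupport f.hasCompactSupport).norm).mul_const _
  · refine (R.norm_rep_apply_le _ _).trans ?_
    rw [R.unitary.norm_map]

/-- The operator `∫ rep (f s) (unitary s) ds`. -/
def integratedOp (f : ConvAlg α μ) : K →L[ℂ] K :=
  LinearMap.mkContinuous
    { toFun x := ∫ s, R.rep (f s) (R.unitary s x) ∂μ
      map_add' x y := by
        simp only [map_add]
        exact integral_add (R.integrable_integrand f x) (R.integrable_integrand f y)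
      map_smul' c x := by
        simp only [map_smul]
        exact integral_smul c _ } f.l1norm (R.norm_integral_le f)

theorem integratedOp_apply (f : ConvAlg α μ) (x : K) :
    R.integratedOp f x = ∫ s, R.rep (f s) (R.unitary s x) ∂μ := rfl

/-- Covariance, `rep (α_r b) U_r = U_r rep b`, absorbs the twist in the convolution; left invariance
and Fubini do the rest. -/
theorem integratedOp_mul (f g : ConvAlg α μ) (x : K) :
    R.integratedOp (f * g) x = R.integratedOp f (R.integratedOp g x) := by
  have hf := f.continuous
  have hg := g.continuous
  have hU := R.rep.continuous_of_cstar
  have h1 : ∀ s, R.rep ((f * g) s) (R.unitary s x)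
      = ∫ r, R.rep (f r) (R.unitary r (R.rep (g (r⁻¹ * s)) (R.unitary (r⁻¹ * s) x))) ∂μ := by
    intro s
    let L : A →L[ℂ] K := (ContinuousLinearMap.apply ℂ K (R.unitary s x)).comp
      ⟨(R.rep : A →ₗ[ℂ] (K →L[ℂ] K)), hU⟩
    rw [ConvAlg.mul_apply]
    refine (L.integral_comp_comm (ConvAlg.conv_integrable f g s)).symm.trans ?_
    congr 1
    ext r
    change R.rep (f r * α r (g (r⁻¹ * s))) (R.unitary s x) = _
    rw [map_mul, ← R.covariant, ← R.unitary.mul_apply, mul_inv_cancel_left]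
    rfl
  have h2 : ∀ r, R.rep (f r) (R.unitary r (R.integratedOp g x))
      = ∫ s, R.rep (f r) (R.unitary r (R.rep (g (r⁻¹ * s)) (R.unitary (r⁻¹ * s) x))) ∂μ := by
    intro r
    have h3 := ((R.rep (f r)).comp (R.unitary r)).integral_comp_comm
      (R.integrable_integrand g x)
    rw [← integral_mul_left_eq_self _ r⁻¹] at h3
    exact h3.symm
  rw [integratedOp_apply, integratedOp_apply]
  simp only [h1, h2]
  refine integral_integral_swap_of_hasCompactSupport (f := fun s r =>
    R.rep (f r) (R.unitary r (R.rep (g (r⁻¹ * s)) (R.unitary (r⁻¹ * s) x)))) ?_ ?_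
  · exact R.continuous_rep_comp (hf.comp continuous_snd)
      (R.unitary.continuous_comp continuous_snd (R.continuous_rep_comp (hg.comp (by fun_prop))
        (R.unitary.continuous_comp (by fun_prop) continuous_const)))
  · refine HasCompactSupport.intro
      ((IsCompact.mul f.hasCompactSupport g.hasCompactSupport).prod f.hasCompactSupport) ?_
    rintro ⟨r, t⟩ hrt
    by_cases ht : t ∈ tsupport f
    · have : t⁻¹ * r ∉ tsupport g := fun h => hrt ⟨⟨t, ht, t⁻¹ * r, h, by simp⟩, ht⟩
      simp [Function.uncurry, image_eq_zero_of_notMem_tsupport this]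
    · simp [Function.uncurry, image_eq_zero_of_notMem_tsupport ht]

/-- The substitution `s ↦ s⁻¹` turns the twisted adjoint at `s⁻¹` into `U_{s⁻¹} rep(f s)⋆` by
covariance, and this is the adjoint of `rep(f s) U_s`. -/
theorem integratedOp_star [μ.IsInvInvariant] (f : ConvAlg α μ) :
    R.integratedOp (star f) = star (R.integratedOp f) := by
  rw [ContinuousLinearMap.star_eq_adjoint, ContinuousLinearMap.eq_adjoint_iff]
  intro x y
  rw [integratedOp_apply, integratedOp_apply]
  have h1 : inner ℂ (∫ s, R.rep (star f s) (R.unitary s x) ∂μ) y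
      = ∫ s, inner ℂ (R.rep (star f s) (R.unitary s x)) y ∂μ := by
    rw [← inner_conj_symm, ← integral_inner (R.integrable_integrand (star f) x) y,
      ← integral_conj]
    simp only [inner_conj_symm]
  rw [h1, ← integral_inner (R.integrable_integrand f y) x,
    ← integral_inv_eq_self _ μ]
  congr 1
  ext s
  rw [ConvAlg.star_apply, inv_inv, R.covariant, R.unitary.inner_map_left, inv_inv, map_star,
    ContinuousLinearMap.star_eq_adjoint, ContinuousLinearMap.adjoint_inner_left]

/-- The integrated form of a covariant representation. -/
def integrated [μ.IsInvInvariant] : ConvAlg α μ →⋆ₙₐ[ℂ] (K →L[ℂ] K) where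
  toFun := R.integratedOp
  map_smul' c f := by
    ext x
    simp only [integratedOp_apply, ConvAlg.smul_apply, map_smul]
    exact integral_smul c _
  map_zero' := by ext x; simp [integratedOp_apply]
  map_add' f g := by
    ext x
    simp only [integratedOp_apply, ConvAlg.add_apply, map_add, add_apply]
    exact integral_add (R.integrable_integrand f x) (R.integrable_integrand g x)
  map_mul' f g := ContinuousLinearMap.ext (R.integratedOp_mul f g)
  map_star' := R.integratedOp_star

variable (μ) in
/-- The integrated form is a nondegenerate representation of the `L¹`-algebra. -/
def toL1Rep [LocallyCompactSpace G] [μ.IsInvInvariant] : L1Rep α μ K where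
  toHom := R.integrated
  norm_le f := (R.integratedOp f).opNorm_le_bound f.l1norm_nonneg (R.norm_integral_le f)
  nondegenerate := by
    rw [Submodule.topologicalClosure_eq_top_iff, Submodule.eq_bot_iff]
    intro y hy
    have hR := R.nondegenerate
    rw [Submodule.topologicalClosure_eq_top_iff, Submodule.eq_bot_iff] at hR
    refine hR y ?_
    rw [Submodule.mem_orthogonal] at hy ⊢
    intro z hz
    -- Let `y` be orthogonal to the range of the integrated form. Tested on `s ↦ b(s) a`, this says
    -- that the continuous function `s ↦ ⟨y, rep(a) U_s x⟩` integrates to zero against every `b`; it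
    -- therefore vanishes at `s = 1`, so `y` is orthogonal to every `rep(a) x`.
    have hle : Submodule.span ℂ {y : K | ∃ a x, R.rep a x = y} ≤ (ℂ ∙ y)ᗮ := by
      rw [Submodule.span_le]
      rintro _ ⟨a, x, rfl⟩
      rw [SetLike.mem_coe, Submodule.mem_orthogonal_singleton_iff_inner_right]
      have key := eq_zero_of_forall_integral_smul_eq_zero μ
        (k := fun s => (inner ℂ y (R.rep a (R.unitary s x)) : ℂ))
        (by
          have := R.continuous_rep_comp (continuous_const (y := a)) (R.unitary.continuous_apply x)
          exact continuous_const.inner this) ?_ 1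
      · simpa only [R.unitary.one_apply] using key
      · intro b
        have hbc : Continuous b := map_continuous b
        let F : ConvAlg α μ := ConvAlg.of ⟨⟨fun s => b s • a, by fun_prop⟩,
          HasCompactSupport.intro b.hasCompactSupport fun s hs => by
            simp [image_eq_zero_of_notMem_tsupport hs]⟩
        have h0 := hy (R.integrated F x) (Submodule.subset_span ⟨F, x, rfl⟩)
        rw [← inner_conj_symm, map_eq_zero] at h0
        change inner ℂ y (∫ s, R.rep (F s) (R.unitary s x) ∂μ) = 0 at h0
        rw [← integral_inner (R.integrable_integrand F x) y] at h0
        refine Eq.trans ?_ h0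
        congr 1
        ext s
        change b s • _ = inner ℂ y (R.rep (b s • a) (R.unitary s x))
        rw [map_smul, smul_apply, inner_smul_right, smul_eq_mul]
    have := hle hz
    rw [Submodule.mem_orthogonal_singleton_iff_inner_left] at this
    exact this

theorem toL1Rep_apply [LocallyCompactSpace G] [μ.IsInvInvariant] (f : ConvAlg α μ) (x : K) :
    (R.toL1Rep μ).toHom f x = ∫ s, R.rep (f s) (R.unitary s x) ∂μ := rfl

end CovariantRep

/-- The scalar representation of `ℂ`. -/
def scalarRep (K : Type*) [NormedAddCommGroup K] [InnerProductSpace ℂ K] [CompleteSpace K] :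
    ℂ →⋆ₙₐ[ℂ] (K →L[ℂ] K) where
  toFun c := c • 1
  map_smul' c d := by simp [mul_smul]
  map_zero' := zero_smul _ _
  map_add' := fun c d => add_smul c d _
  map_mul' c d := by simp [mul_smul, smul_comm c d]
  map_star' c := by simp [star_smul]

/-- A unitary representation, as a covariant representation of the trivial action on `ℂ`. -/
def UnitaryRep.toCovariantRep {G K : Type*} [Group G] [TopologicalSpace G]
    [NormedAddCommGroup K] [InnerProductSpace ℂ K] [CompleteSpace K] (W : UnitaryRep G K) :
    CovariantRep (CStarAction.trivial G ℂ) K where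
  rep := scalarRep K
  unitary := W
  covariant g a x := by
    change a • W g x = W g (a • x)
    rw [map_smul]
  nondegenerate := by
    rw [eq_top_iff]
    exact fun x _ => Submodule.le_topologicalClosure _ (Submodule.subset_span
      ⟨1, x, by simp [scalarRep]⟩)

/-! ### Representations of the crossed product. -/

namespace L1Rep

variable {G : Type u} {A : Type v} [CommGroup G] [TopologicalSpace G] [IsTopologicalGroup G]
  [MeasurableSpace G] [BorelSpace G] [NonUnitalCStarAlgebra A]
  {α : CStarAction G A} {μ : Measure G} [μ.IsHaarMeasure]
  {K : Type (max u v)} [NormedAddCommGroup K] [InnerProductSpace ℂ K] [CompleteSpace K]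

/-- The extension of a representation to the crossed product. -/
def lift (π : L1Rep α μ K) : CrossedProduct α μ →⋆ₙₐ[ℂ] (K →L[ℂ] K) :=
  CStarCompletion.lift π.toHom fun f => ConvAlg.rep_le_univNorm f π

theorem lift_incl (π : L1Rep α μ K) (f : ConvAlg α μ) :
    π.lift (CStarCompletion.incl f) = π.toHom f := CStarCompletion.lift_incl _ _ f

end L1Rep

/-- The representations of the `L¹`-algebra separate the points of the crossed product. -/
theorem CrossedProduct.eq_zero_of_forall_lift_eq_zero {G : Type u} {A : Type v} [CommGroup G]
    [TopologicalSpace G] [IsTopologicalGroup G] [MeasurableSpace G] [BorelSpace G]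
    [NonUnitalCStarAlgebra A] {α : CStarAction G A} {μ : Measure G} [μ.IsHaarMeasure]
    (a : CrossedProduct α μ)
    (h : ∀ (K : Type (max u v)) [NormedAddCommGroup K] [InnerProductSpace ℂ K]
      [CompleteSpace K] (π : L1Rep α μ K), π.lift a = 0) : a = 0 := by
  rw [← norm_le_zero_iff]
  refine le_of_forall_pos_le_add fun e he => ?_
  obtain ⟨f, hf⟩ := Metric.denseRange_iff.1 CStarCompletion.denseRange_incl a (e / 2) (half_pos he)
  rw [dist_eq_norm] at hf
  -- Every `π` kills `a`, so `‖π(f)‖ = ‖π(a - f)‖ ≤ e / 2`, and the supremum over `π` is the norm of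
  -- `f`.
  have h1 : f.univNorm ≤ e / 2 := ConvAlg.univNorm_le_of_rep (half_pos he).le fun K _ _ _ π => by
    have h2 := NonUnitalStarAlgHom.norm_apply_le π.lift (a - CStarCompletion.incl f)
    rw [map_sub, h K π, zero_sub, norm_neg, L1Rep.lift_incl] at h2
    exact h2.trans hf.le
  have h3 : ‖CStarCompletion.incl f‖ ≤ e / 2 := (CStarCompletion.norm_incl f).trans_le h1
  calc ‖a‖ = ‖a - CStarCompletion.incl f + CStarCompletion.incl f‖ := by rw [sub_add_cancel]
    _ ≤ e / 2 + e / 2 := (norm_add_le _ _).trans (add_le_add hf.le h3)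
    _ = 0 + e := by ring

end
-- Unitary operators induced by multipliers.
noncomputable section

open scoped TensorProduct Pointwise

namespace L1Rep

variable {G : Type u} {A : Type v} [CommGroup G] [TopologicalSpace G] [IsTopologicalGroup G]
  [MeasurableSpace G] [BorelSpace G] [NonUnitalCStarAlgebra A]
  {α : CStarAction G A} {μ : Measure G} [μ.IsHaarMeasure]
  {K : Type*} [NormedAddCommGroup K] [InnerProductSpace ℂ K] [CompleteSpace K]
  (π : L1Rep α μ K)

theorem norm_apply_le (f : ConvAlg α μ) (x : K) : ‖π.toHom f x‖ ≤ ‖x‖ * f.l1norm := by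
  rw [mul_comm]
  exact ((π.toHom f).le_opNorm x).trans
    (mul_le_mul_of_nonneg_right (π.norm_le f) (norm_nonneg x))

/-- The map `f ↦ π(f) x`. -/
def orbit (x : K) : ConvAlg α μ →ₗ[ℂ] K where
  toFun f := π.toHom f x
  map_add' f g := by simp
  map_smul' c f := by simp

/-- The linear map `f ⊗ x ↦ π(f) x`. -/
def evalTensor : ConvAlg α μ ⊗[ℂ] K →ₗ[ℂ] K :=
  TensorProduct.lift (LinearMap.mk₂ ℂ (fun f x => π.toHom f x) (by simp) (by simp) (by simp)
    (by simp))

theorem evalTensor_tmul (f : ConvAlg α μ) (x : K) : π.evalTensor (f ⊗ₜ x) = π.toHom f x := rfl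

theorem denseRange_evalTensor : DenseRange π.evalTensor := by
  have h : Submodule.span ℂ {y : K | ∃ f x, π.toHom f x = y} ≤ LinearMap.range π.evalTensor := by
    rw [Submodule.span_le]
    rintro _ ⟨f, x, rfl⟩
    exact ⟨f ⊗ₜ x, rfl⟩
  have h2 := Submodule.topologicalClosure_mono h
  rw [π.nondegenerate, top_le_iff] at h2
  exact Submodule.dense_iff_topologicalClosure_eq_top.2 h2

/-- Continuous linear maps which agree on the vectors `π(f) x` agree. -/
theorem clm_ext {S T : K →L[ℂ] K} (h : ∀ f x, S (π.toHom f x) = T (π.toHom f x)) : S = T := by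
  apply ContinuousLinearMap.coeFn_injective
  refine π.denseRange_evalTensor.equalizer S.continuous T.continuous ?_
  ext z
  induction z using TensorProduct.induction_on with
  | zero => simp
  | tmul f x => exact h f x
  | add z w hz hw => simp only [Function.comp_apply, map_add] at *; rw [hz, hw]

variable (m : ConvAlg α μ →ₗ[ℂ] ConvAlg α μ)

/-- The operator determined by `π(f) x ↦ π(m f) x`. -/
def multiplier : K →L[ℂ] K :=
  (π.evalTensor.comp (m.rTensor K)).extendOfNorm π.evalTensor

variable {m}

/-- The inner product `⟨π(f) x, π(g) y⟩ = ⟨x, π(f⋆ g) y⟩` depends on `f` and `g` only through `f⋆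
g`, which `m` preserves. Working on the tensor product avoids choosing a representation of a vector
as a sum of terms `π(f) x`; the resulting equality of norms makes the induced operator well defined
and isometric. -/
theorem inner_evalTensor_rTensor (hm : ∀ f g, star (m f) * m g = star f * g)
    (z w : ConvAlg α μ ⊗[ℂ] K) :
    inner ℂ (π.evalTensor (m.rTensor K z)) (π.evalTensor (m.rTensor K w))
      = inner ℂ (π.evalTensor z) (π.evalTensor w) := by
  have key : ∀ f g x y, inner ℂ (π.toHom f x) (π.toHom g y)
      = inner ℂ x (π.toHom (star f * g) y) := fun f g x y => by
    rw [map_mul, map_star, ContinuousLinearMap.star_eq_adjoint, mul_apply_eq_comp,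
      ContinuousLinearMap.adjoint_inner_right]
  induction z using TensorProduct.induction_on with
  | zero => simp
  | add z z' hz hz' => simp only [map_add, inner_add_left, hz, hz']
  | tmul f x =>
    induction w using TensorProduct.induction_on with
    | zero => simp
    | add w w' hw hw' => simp only [map_add, inner_add_right, hw, hw']
    | tmul g y =>
      simp only [LinearMap.rTensor_tmul, evalTensor_tmul, key, hm]

theorem norm_evalTensor_rTensor (hm : ∀ f g, star (m f) * m g = star f * g)
    (z : ConvAlg α μ ⊗[ℂ] K) : ‖π.evalTensor (m.rTensor K z)‖ = ‖π.evalTensor z‖ := by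
  rw [@norm_eq_sqrt_re_inner ℂ, @norm_eq_sqrt_re_inner ℂ, π.inner_evalTensor_rTensor hm]

theorem multiplier_evalTensor (hm : ∀ f g, star (m f) * m g = star f * g)
    (z : ConvAlg α μ ⊗[ℂ] K) :
    π.multiplier m (π.evalTensor z) = π.evalTensor (m.rTensor K z) :=
  LinearMap.extendOfNorm_eq π.denseRange_evalTensor
    ⟨1, fun z => by rw [one_mul]; exact (π.norm_evalTensor_rTensor hm z).le⟩ z

theorem multiplier_apply (hm : ∀ f g, star (m f) * m g = star f * g) (f : ConvAlg α μ) (x : K) :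
    π.multiplier m (π.toHom f x) = π.toHom (m f) x :=
  π.multiplier_evalTensor hm (f ⊗ₜ x)

theorem norm_multiplier (hm : ∀ f g, star (m f) * m g = star f * g) (x : K) :
    ‖π.multiplier m x‖ = ‖x‖ := by
  refine π.denseRange_evalTensor.induction_on x
    (isClosed_eq (π.multiplier m).continuous.norm continuous_norm) fun z => ?_
  rw [π.multiplier_evalTensor hm, π.norm_evalTensor_rTensor hm]

/-- The unitary representation determined by a group of unitary multipliers. -/
def unitaryOf {S : Type*} [Group S] [TopologicalSpace S] (m : S →* Module.End ℂ (ConvAlg α μ))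
    (hm : ∀ s f g, star (m s f) * m s g = star f * g)
    (hc : ∀ f x, Continuous fun s => π.toHom (m s f) x) : UnitaryRep S K where
  toHom :=
    { toFun s := π.multiplier (m s)
      map_one' := π.clm_ext fun f x => by rw [π.multiplier_apply (hm 1), map_one]; rfl
      map_mul' s t := π.clm_ext fun f x => by
        rw [π.multiplier_apply (hm _), mul_apply_eq_comp, π.multiplier_apply (hm _),
          π.multiplier_apply (hm _), map_mul]
        rfl }
  norm_map s := π.norm_multiplier (hm s)
  continuous_apply x := by
    have h1 : ∀ z, Continuous fun s => π.multiplier (m s) (π.evalTensor z) := fun z => by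
      induction z using TensorProduct.induction_on with
      | zero => simpa using continuous_const
      | tmul f x =>
        simpa only [π.evalTensor_tmul, π.multiplier_apply (hm _)] using hc f x
      | add z w hz hw => simp only [map_add]; exact hz.add hw
    -- All operators are isometric, so approximating `x` by a vector in the range of `evalTensor` is
    -- uniform in `s`, and continuity passes to the limit.
    refine continuous_of_uniform_approx_of_continuous fun U hU => ?_
    obtain ⟨e, he, heU⟩ := Metric.mem_uniformity_dist.1 hU
    obtain ⟨z, hz⟩ := Metric.denseRange_iff.1 π.denseRange_evalTensor x e he
    refine ⟨_, h1 z, fun s => heU ?_⟩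
    change dist (π.multiplier (m s) x) _ < e
    rwa [dist_eq_norm, ← map_sub, π.norm_multiplier (hm s), ← dist_eq_norm]

theorem unitaryOf_apply {S : Type*} [Group S] [TopologicalSpace S]
    (m : S →* Module.End ℂ (ConvAlg α μ))
    (hm : ∀ s f g, star (m s f) * m s g = star f * g)
    (hc : ∀ f x, Continuous fun s => π.toHom (m s f) x) (s : S) (f : ConvAlg α μ) (x : K) :
    π.unitaryOf m hm hc s (π.toHom f x) = π.toHom (m s f) x :=
  π.multiplier_apply (hm s) f x

end L1Rep

/-! ### Translations and coefficient maps as unitary multipliers. -/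

namespace ConvAlg

variable {G : Type u} {A : Type v} [CommGroup G] [TopologicalSpace G] [IsTopologicalGroup G]
  [MeasurableSpace G] [BorelSpace G] [NonUnitalCStarAlgebra A]
  {α : CStarAction G A} {μ : Measure G} [μ.IsHaarMeasure]

/-- The twisted translations `(s · f)(t) = α_s(f(s⁻¹ t))`. -/
def translate : G →* Module.End ℂ (ConvAlg α μ) where
  toFun s :=
    { toFun f := of ⟨⟨fun t => α s (f (s⁻¹ * t)),
        α.continuous_comp continuous_const (f.continuous.comp (continuous_const_mul _))⟩,
        HasCompactSupport.intro (f.hasCompactSupport.isCompact.image (continuous_const_mul s))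
          fun t ht => by
            have : s⁻¹ * t ∉ tsupport f := fun h => ht ⟨_, h, by simp⟩
            simp [image_eq_zero_of_notMem_tsupport this]⟩
      map_add' f g := by ext t; exact map_add (α s) _ _
      map_smul' c f := by ext t; exact map_smul (α s) _ _ }
  map_one' := by
    ext f t
    change α 1 (f (1⁻¹ * t)) = f t
    simp
  map_mul' s r := by
    ext f t
    change α (s * r) (f ((s * r)⁻¹ * t)) = α s (α r (f (r⁻¹ * (s⁻¹ * t))))
    rw [α.mul_apply, mul_inv_rev, mul_assoc]

theorem translate_apply (s : G) (f : ConvAlg α μ) (t : G) :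
    translate s f t = α s (f (s⁻¹ * t)) := rfl

/-- The automorphisms `α_r` and `α_s` combine to `α_{rs}`, so the two integrands differ by the
substitution `r ↦ r s`. -/
theorem star_translate_mul (s : G) (f g : ConvAlg α μ) :
    star (translate s f) * translate s g = star f * g := by
  ext t
  rw [mul_apply, mul_apply]
  refine Eq.trans ?_ (integral_mul_right_eq_self _ s)
  congr 1
  ext r
  simp only [star_apply, translate_apply, ← map_star, ← α.mul_apply, mul_inv_rev, mul_assoc]

/-- By the C⋆-identity the norm is determined by `f⋆ f`, which translation does not change. -/
theorem norm_translate (s : G) (f : ConvAlg α μ) : ‖translate s f‖ = ‖f‖ := by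
  have h : ∀ g : ConvAlg α μ, ‖g‖ * ‖g‖ = ‖star g * g‖ := fun g =>
    le_antisymm (PreCStarAlgebra.norm_mul_self_le g) ((norm_mul_le _ _).trans
      (mul_le_mul_of_nonneg_right (PreCStarAlgebra.norm_star_le g) (norm_nonneg g)))
  have h1 := h (translate s f)
  rw [star_translate_mul, ← h f] at h1
  exact (mul_self_inj (norm_nonneg _) (norm_nonneg _)).1 h1

theorem continuous_translate_apply (f : ConvAlg α μ) :
    Continuous fun p : G × G => translate p.1 f p.2 :=
  α.continuous_comp continuous_fst (f.continuous.comp (by fun_prop))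

/-- `L¹`-bounded linear maps are continuous along translations. -/
theorem continuous_map_translate [LocallyCompactSpace G] {X : Type*} [NormedAddCommGroup X]
    [NormedSpace ℂ X] (T : ConvAlg α μ →ₗ[ℂ] X) {C : ℝ} (hT : ∀ f, ‖T f‖ ≤ C * f.l1norm)
    (f : ConvAlg α μ) : Continuous fun s => T (translate s f) := by
  refine continuous_of_l1norm_bound T hT _ (continuous_translate_apply f) fun s => ?_
  obtain ⟨N, hN, hNs⟩ := exists_compact_mem_nhds s
  refine ⟨N, hNs, N * tsupport f, hN.mul f.hasCompactSupport, fun r hr t ht => ?_⟩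
  have : r⁻¹ * t ∉ tsupport f := fun h => ht ⟨r, hr, _, h, by simp⟩
  rw [translate_apply, image_eq_zero_of_notMem_tsupport this, map_zero]

/-- Composition with a continuous linear endomorphism of the coefficient algebra. -/
def mapCoeff : (A →L[ℂ] A) →* Module.End ℂ (ConvAlg α μ) where
  toFun l :=
    { toFun f := of ⟨⟨fun t => l (f t), l.continuous.comp f.continuous⟩,
        HasCompactSupport.intro f.hasCompactSupport fun t ht => by
          simp [image_eq_zero_of_notMem_tsupport ht]⟩
      map_add' f g := by ext t; exact map_add l _ _
      map_smul' c f := by ext t; exact map_smul l _ _ }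
  map_one' := rfl
  map_mul' _ _ := rfl

theorem mapCoeff_apply (l : A →L[ℂ] A) (f : ConvAlg α μ) (t : G) : mapCoeff l f t = l (f t) := rfl

theorem star_mapCoeff_mul {l : A →L[ℂ] A} (hl : ∀ a b, star (l a) * l b = star a * b)
    (f g : ConvAlg α μ) : star (mapCoeff l f) * mapCoeff l g = star f * g := by
  ext t
  rw [mul_apply, mul_apply]
  congr 1
  ext r
  rw [star_apply, star_apply, ← map_mul, ← map_mul, mapCoeff_apply, mapCoeff_apply, hl]

end ConvAlg

/-! ### The canonical unitary multipliers of the completed crossed product. -/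

namespace CrossedProduct

variable {G : Type u} {A : Type v} [CommGroup G] [TopologicalSpace G] [IsTopologicalGroup G]
  [MeasurableSpace G] [BorelSpace G] [NonUnitalCStarAlgebra A]
  {α : CStarAction G A} {μ : Measure G} [μ.IsHaarMeasure]

open CStarCompletion

theorem norm_inclₗ_le (f : ConvAlg α μ) :
    ‖(inclₗ f : CrossedProduct α μ)‖ ≤ 1 * f.l1norm := by
  rw [one_mul]
  exact (norm_incl f).trans_le f.univNorm_le_l1norm

theorem exists_translate_bound (s : G) : ∃ C : ℝ, ∀ f : ConvAlg α μ,
    ‖(inclₗ.comp (ConvAlg.translate s)) f‖ ≤ C * ‖(inclₗ f : CrossedProduct α μ)‖ :=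
  ⟨1, fun f => by
    rw [one_mul]
    exact ((norm_incl _).trans (ConvAlg.norm_translate s f)).trans_le (norm_incl f).ge⟩

theorem clm_ext {X : Type*} [NormedAddCommGroup X] [NormedSpace ℂ X]
    {S T : CrossedProduct α μ →L[ℂ] X} (h : ∀ f, S (incl f) = T (incl f)) : S = T :=
  ContinuousLinearMap.coeFn_injective <|
    denseRange_incl.equalizer S.continuous T.continuous (funext h)

/-- The canonical unitary multipliers of the crossed product. -/
def translate : G →* (CrossedProduct α μ →L[ℂ] CrossedProduct α μ) :=
  have h (s : G) (f : ConvAlg α μ) :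
      (inclₗ.comp (ConvAlg.translate s)).extendOfNorm inclₗ (incl f)
        = (incl (ConvAlg.translate s f) : CrossedProduct α μ) :=
    LinearMap.extendOfNorm_eq (e := inclₗ) denseRange_incl (exists_translate_bound s) f
  { toFun s := (inclₗ.comp (ConvAlg.translate s)).extendOfNorm inclₗ
    map_one' := clm_ext fun f => by rw [h, map_one]; rfl
    map_mul' s t := clm_ext fun f => by
      rw [mul_apply_eq_comp, h, h, h, map_mul]
      rfl }

theorem translate_incl (s : G) (f : ConvAlg α μ) :
    translate s (incl f : CrossedProduct α μ) = incl (ConvAlg.translate s f) :=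
  LinearMap.extendOfNorm_eq (e := inclₗ) denseRange_incl (exists_translate_bound s) f

theorem star_translate_mul (s : G) (a b : CrossedProduct α μ) :
    star (translate s a) * translate s b = star a * b := by
  have hc := (translate s : CrossedProduct α μ →L[ℂ] CrossedProduct α μ).continuous
  induction a using induction_on with
  | hp => exact isClosed_eq (hc.star.mul continuous_const) (continuous_star.mul continuous_const)
  | ih a =>
  induction b using induction_on with
  | hp => exact isClosed_eq (continuous_const.mul hc) (continuous_const.mul continuous_id)
  | ih b =>
  rw [translate_incl, translate_incl, ← incl_star, ← incl_mul, ConvAlg.star_translate_mul,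
    incl_mul, incl_star]

theorem norm_translate (s : G) (a : CrossedProduct α μ) : ‖translate s a‖ = ‖a‖ := by
  induction a using induction_on with
  | hp => exact isClosed_eq (translate s).continuous.norm continuous_norm
  | ih a => rw [translate_incl, norm_incl, norm_incl, ConvAlg.norm_translate]

theorem continuous_translate [LocallyCompactSpace G] (a : CrossedProduct α μ) :
    Continuous fun s => translate s a := by
  refine continuous_of_uniform_approx_of_continuous fun U hU => ?_
  obtain ⟨e, he, heU⟩ := Metric.mem_uniformity_dist.1 hU
  obtain ⟨f, hf⟩ := Metric.denseRange_iff.1 denseRange_incl a e he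
  refine ⟨_, ConvAlg.continuous_map_translate inclₗ norm_inclₗ_le f, fun s => heU ?_⟩
  change dist _ (incl _) < e
  rwa [← translate_incl, dist_eq_norm, ← map_sub, norm_translate, ← dist_eq_norm]

theorem continuous_translate_uncurry [LocallyCompactSpace G] :
    Continuous fun p : G × CrossedProduct α μ => translate p.1 p.2 := by
  rw [continuous_iff_continuousAt]
  rintro ⟨g, a⟩
  rw [ContinuousAt, tendsto_iff_norm_sub_tendsto_zero]
  have h1 : Filter.Tendsto (fun p : G × CrossedProduct α μ =>
      ‖p.2 - a‖ + ‖translate p.1 a - translate g a‖) (𝓝 (g, a)) (𝓝 0) := by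
    have : Continuous fun p : G × CrossedProduct α μ =>
        ‖p.2 - a‖ + ‖translate p.1 a - translate g a‖ := by
      have := (continuous_translate a).comp (continuous_fst (X := G) (Y := CrossedProduct α μ))
      simp only [Function.comp_def] at this
      fun_prop
    simpa using this.tendsto (g, a)
  refine squeeze_zero (fun _ => norm_nonneg _) (fun p => ?_) h1
  have : translate p.1 p.2 - translate g a
      = translate p.1 (p.2 - a) + (translate p.1 a - translate g a) := by
    rw [map_sub]; abel
  rw [this]
  refine (norm_add_le _ _).trans ?_
  rw [norm_translate]

theorem continuous_translate_comp [LocallyCompactSpace G] {Y : Type*} [TopologicalSpace Y]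
    {s : Y → G} {a : Y → CrossedProduct α μ} (hs : Continuous s) (ha : Continuous a) :
    Continuous fun y => translate (s y) (a y) := by
  have h := (continuous_translate_uncurry (α := α) (μ := μ)).comp (hs.prodMk ha)
  simpa only [Function.comp_def] using h

end CrossedProduct

/-- Left multiplication by `f ∈ C_c(G)` on `C⋆(G)` is the integral of the translations. -/
theorem GroupCStar.of_mul {G : Type u} [CommGroup G] [TopologicalSpace G] [IsTopologicalGroup G]
    [LocallyCompactSpace G] [MeasurableSpace G] [BorelSpace G] (μ : Measure G) [μ.IsHaarMeasure]
    (f : C_c(G, ℂ)) (b : GroupCStar μ) :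
    GroupCStar.of μ f * b = ∫ s, f s • CrossedProduct.translate s b ∂μ := by
  have hf : Continuous f := map_continuous f
  induction b using CStarCompletion.induction_on with
  | hp =>
    refine isClosed_eq (continuous_const.mul continuous_id) ?_
    rw [← continuousOn_univ]
    refine continuousOn_integral_of_compact_support (k := tsupport f) f.hasCompactSupport ?_ ?_
    · exact ((hf.comp continuous_snd).smul (CrossedProduct.continuous_translate_comp
        continuous_snd continuous_fst)).continuousOn
    · intro b s _ hs
      rw [image_eq_zero_of_notMem_tsupport hs, zero_smul]
  | ih g =>
  simp only [CrossedProduct.translate_incl]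
  unfold GroupCStar.of
  rw [← CStarCompletion.incl_mul]
  -- For compactly supported `g` the identity holds pointwise by definition of convolution; the
  -- inclusion into the completion is `L¹`-bounded and carries it over.
  have h := ConvAlg.map_integral_of_l1norm_bound
    (CStarCompletion.inclₗ : ConvAlg (CStarAction.trivial G ℂ) μ →ₗ[ℂ] GroupCStar μ)
    zero_le_one CrossedProduct.norm_inclₗ_le μ (fun s => f s • ConvAlg.translate s g)
    (ConvAlg.of f * g) (K := tsupport f) (D := tsupport f * tsupport g) ?_ f.hasCompactSupport
    (IsCompact.mul f.hasCompactSupport g.hasCompactSupport) ?_ ?_ ?_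
  · refine h.trans ?_
    simp only [map_smul]
    rfl
  · exact (hf.comp continuous_fst).smul (ConvAlg.continuous_translate_apply g)
  · intro s hs t
    simp [image_eq_zero_of_notMem_tsupport hs]
  · intro s t ht
    by_cases hs : s ∈ tsupport f
    · have : s⁻¹ * t ∉ tsupport g := fun h => ht ⟨s, hs, _, h, by simp⟩
      simp [ConvAlg.translate_apply, image_eq_zero_of_notMem_tsupport this]
    · simp [image_eq_zero_of_notMem_tsupport hs]
  · intro t
    rfl

end
-- Group C⋆-algebras and the pairing of the two groups.
noncomputable section

open scoped Pointwise

open CStarCompletion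

section Duality

variable {G H : Type u} [CommGroup G] [TopologicalSpace G] [IsTopologicalGroup G]
  [LocallyCompactSpace G] [MeasurableSpace G] [BorelSpace G] {μ : Measure G} [μ.IsHaarMeasure]
  [CommGroup H] [TopologicalSpace H] [IsTopologicalGroup H]
  [LocallyCompactSpace H] [MeasurableSpace H] [BorelSpace H] {ν : Measure H} [ν.IsHaarMeasure]

/-- The element of `C_c(H, C⋆(G))` defined by a function of two variables. -/
def ConvAlg.ofProd (δ : CStarAction H (GroupCStar μ)) (ν : Measure H) (f : C_c(G × H, ℂ)) :
    ConvAlg δ ν :=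
  ConvAlg.of
    ⟨⟨fun h => GroupCStar.of μ (sliceLeft f h), continuous_sliceLeft f⟩, by
      refine HasCompactSupport.intro (f.hasCompactSupport.isCompact.image continuous_snd)
        (fun h hh => ?_)
      have : sliceLeft f h = 0 := by
        ext g
        exact image_eq_zero_of_notMem_tsupport (f := f) fun hmem => hh ⟨(g, h), hmem, rfl⟩
      change GroupCStar.of μ (sliceLeft f h) = 0
      rw [this]
      rfl⟩

theorem CrossedProduct.ofProd_eq_incl (δ : CStarAction H (GroupCStar μ)) (f : C_c(G × H, ℂ)) :
    CrossedProduct.ofProd δ ν f = incl (ConvAlg.ofProd δ ν f) := rfl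

theorem ConvAlg.ofProd_apply (δ : CStarAction H (GroupCStar μ)) (f : C_c(G × H, ℂ)) (h : H) :
    ConvAlg.ofProd δ ν f h = GroupCStar.of μ (sliceLeft f h) := rfl

theorem GroupCStar.induction_on {p : GroupCStar μ → Prop} (a : GroupCStar μ)
    (hp : IsClosed {a | p a}) (ih : ∀ f : C_c(G, ℂ), p (GroupCStar.of μ f)) : p a :=
  CStarCompletion.induction_on a hp ih

theorem CStarAction.continuous_apply_right {S B : Type*} [Group S] [TopologicalSpace S]
    [NonUnitalCStarAlgebra B] (α : CStarAction S B) (s : S) : Continuous fun a => α s a :=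
  α.continuous_comp continuous_const continuous_id

-- Regular Haar measures on abelian groups are inversion invariant, as the adjoint of an integrated
-- form requires.
variable [μ.Regular] [ν.Regular]

namespace UnitaryRep

variable {K : Type u} [NormedAddCommGroup K] [InnerProductSpace ℂ K] [CompleteSpace K]

variable (μ) in
/-- The representation of the group C⋆-algebra defined by a unitary representation. -/
def toGroupCStar (W : UnitaryRep G K) : GroupCStar μ →⋆ₙₐ[ℂ] (K →L[ℂ] K) :=
  (W.toCovariantRep.toL1Rep μ).lift

theorem toGroupCStar_of (W : UnitaryRep G K) (f : C_c(G, ℂ)) (x : K) :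
    W.toGroupCStar μ (GroupCStar.of μ f) x = ∫ g, f g • W g x ∂μ := by
  unfold toGroupCStar GroupCStar.of
  rw [L1Rep.lift_incl]
  rfl

theorem nondegenerate_toGroupCStar (W : UnitaryRep G K) :
    (Submodule.span ℂ {y : K | ∃ a x, W.toGroupCStar μ a x = y}).topologicalClosure = ⊤ := by
  rw [eq_top_iff, ← (W.toCovariantRep.toL1Rep μ).nondegenerate]
  refine Submodule.topologicalClosure_mono (Submodule.span_mono ?_)
  rintro _ ⟨f, x, rfl⟩
  exact ⟨incl f, x, by rw [toGroupCStar, L1Rep.lift_incl]⟩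

end UnitaryRep

/-- The action on `C⋆(G)` is given by pointwise multiplication by characters. -/
def CStarAction.ActsBy (δ : CStarAction H (GroupCStar μ)) (β : H →* G →* Circle) : Prop :=
  ∀ (h : H) (f f' : C_c(G, ℂ)), (∀ g, f' g = (β h g : ℂ) * f g) →
    δ h (GroupCStar.of μ f) = GroupCStar.of μ f'

/-- The opposite pairing `(g, h) ↦ β(h, g⁻¹)`. -/
def dualPairing (β : H →* G →* Circle) : G →* H →* Circle := β.flip.comp invMonoidHom

theorem dualPairing_apply (β : H →* G →* Circle) (g : G) (h : H) :
    dualPairing β g h = β h g⁻¹ := rfl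

theorem continuous_dualPairing (β : H →* G →* Circle)
    (hβ : Continuous fun p : H × G => (β p.1 p.2 : ℂ)) :
    Continuous fun p : G × H => (dualPairing β p.1 p.2 : ℂ) :=
  hβ.comp (continuous_snd.prodMk continuous_fst.inv)

variable {β : H →* G →* Circle} {δ : CStarAction H (GroupCStar μ)}
  {ε : CStarAction G (GroupCStar ν)}

/-- Multiplication of a compactly supported continuous function by a continuous function. -/
def CompactlySupportedContinuousMap.mulContinuous {Y : Type*} [TopologicalSpace Y] [R1Space Y]
    (b : Y → ℂ) (hb : Continuous b) (f : C_c(Y, ℂ)) : C_c(Y, ℂ) :=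
  ⟨⟨fun y => b y * f y, hb.mul (map_continuous f)⟩,
    HasCompactSupport.intro f.hasCompactSupport fun y hy => by
      simp [image_eq_zero_of_notMem_tsupport hy]⟩

/-- This is the Weyl relation inside the multipliers of `C⋆(H)`. On `C_c(H)` it is the identity
`β(h⁻¹ t, g⁻¹) = β(h, g) β(t, g⁻¹)`; density does the rest. -/
theorem translate_action_eq_smul (hβ : Continuous fun p : H × G => (β p.1 p.2 : ℂ))
    (hε : ε.ActsBy (dualPairing β)) (h : H) (g : G) (a : GroupCStar ν) :
    CrossedProduct.translate h (ε g a) = (β h g : ℂ) • ε g (CrossedProduct.translate h a) := by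
  induction a using GroupCStar.induction_on with
  | hp =>
    have h1 : Continuous fun a => ε g (CrossedProduct.translate h a) :=
      (ε.continuous_apply_right g).comp (CrossedProduct.translate h).continuous
    exact isClosed_eq ((CrossedProduct.translate h).continuous.comp (ε.continuous_apply_right g))
      ((continuous_const_smul (β h g : ℂ)).comp h1)
  | ih k =>
  have hb : Continuous fun t : H => (β t g⁻¹ : ℂ) := hβ.comp (Continuous.prodMk_left g⁻¹)
  let k' := CompactlySupportedContinuousMap.mulContinuous _ hb k
  let l : C_c(H, ℂ) := ConvAlg.translate (α := CStarAction.trivial H ℂ) (μ := ν) h (ConvAlg.of k)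
  let l' := CompactlySupportedContinuousMap.mulContinuous _ hb l
  have h1 : CrossedProduct.translate h (GroupCStar.of ν k) = GroupCStar.of ν l :=
    CrossedProduct.translate_incl h _
  rw [hε g k k' fun _ => rfl, h1, hε g l l' fun _ => rfl]
  unfold GroupCStar.of
  rw [CrossedProduct.translate_incl, ← incl_smul]
  congr 1
  ext t
  change (β (h⁻¹ * t) g⁻¹ : ℂ) * k (h⁻¹ * t) = (β h g : ℂ) * ((β t g⁻¹ : ℂ) * k (h⁻¹ * t))
  simp [mul_assoc]

/-! ### The Weyl pair of a representation and the exchange of its two members. -/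

namespace L1Rep

variable {K : Type u} [NormedAddCommGroup K] [InnerProductSpace ℂ K] [CompleteSpace K]
  (π : L1Rep ε μ K)

/-- The unitary representation of `G` underlying a representation of `C⋆(H) ⋊ G`. -/
def outerUnitary : UnitaryRep G K :=
  π.unitaryOf ConvAlg.translate ConvAlg.star_translate_mul fun f x =>
    ConvAlg.continuous_map_translate (π.orbit x) (fun f => π.norm_apply_le f x) f

theorem outerUnitary_apply (g : G) (f : ConvAlg ε μ) (x : K) :
    π.outerUnitary g (π.toHom f x) = π.toHom (ConvAlg.translate g f) x :=
  π.unitaryOf_apply _ _ _ g f x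

theorem continuous_mapCoeff_translate (f : ConvAlg ε μ) :
    Continuous fun p : H × G => ConvAlg.mapCoeff (CrossedProduct.translate p.1) f p.2 :=
  CrossedProduct.continuous_translate_comp continuous_fst (f.continuous.comp continuous_snd)

/-- The unitary representation of `H` underlying a representation of `C⋆(H) ⋊ G`. -/
def innerUnitary : UnitaryRep H K :=
  π.unitaryOf (ConvAlg.mapCoeff.comp CrossedProduct.translate)
    (fun h => ConvAlg.star_mapCoeff_mul (CrossedProduct.star_translate_mul h)) fun f x => by
    refine ConvAlg.continuous_of_l1norm_bound (π.orbit x) (fun f => π.norm_apply_le f x)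
      (fun h => ConvAlg.mapCoeff (CrossedProduct.translate h) f)
      (continuous_mapCoeff_translate f) fun h => ?_
    refine ⟨Set.univ, Filter.univ_mem, tsupport f, f.hasCompactSupport, fun h _ t ht => ?_⟩
    rw [ConvAlg.mapCoeff_apply, image_eq_zero_of_notMem_tsupport ht, map_zero]

theorem innerUnitary_apply (h : H) (f : ConvAlg ε μ) (x : K) :
    π.innerUnitary h (π.toHom f x)
      = π.toHom (ConvAlg.mapCoeff (CrossedProduct.translate h) f) x :=
  π.unitaryOf_apply _ _ _ h f x

theorem innerUnitary_outerUnitary (hβ : Continuous fun p : H × G => (β p.1 p.2 : ℂ))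
    (hε : ε.ActsBy (dualPairing β)) (h : H) (g : G) (x : K) :
    π.innerUnitary h (π.outerUnitary g x)
      = (β h g : ℂ) • π.outerUnitary g (π.innerUnitary h x) := by
  have : π.innerUnitary h * π.outerUnitary g
      = (β h g : ℂ) • (π.outerUnitary g * π.innerUnitary h) := by
    refine π.clm_ext fun f x => ?_
    rw [smul_apply, mul_apply_eq_comp, mul_apply_eq_comp, outerUnitary_apply,
      innerUnitary_apply, innerUnitary_apply, outerUnitary_apply, ← smul_apply, ← map_smul]
    congr 2
    ext t
    exact translate_action_eq_smul hβ hε h g _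
  exact congrArg (fun T : K →L[ℂ] K => T x) this

/-- The representation of `C⋆(G) ⋊ H` with the same underlying unitary representations. -/
def dualCovariantRep (hβ : Continuous fun p : H × G => (β p.1 p.2 : ℂ))
    (hδ : δ.ActsBy β) (hε : ε.ActsBy (dualPairing β)) : CovariantRep δ K where
  rep := π.outerUnitary.toGroupCStar μ
  unitary := π.innerUnitary
  -- For `a` in `C_c(G)`, moving `W_h` past each `U_g` under the integral multiplies the integrand
  -- by `β(h, g)`, which is the effect of `δ_h`. Both sides are continuous in `a`.
  covariant h a x := by
    have hU := (π.outerUnitary.toGroupCStar μ).continuous_of_cstar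
    induction a using GroupCStar.induction_on with
    | hp =>
      exact isClosed_eq ((hU.comp (δ.continuous_apply_right h)).clm_apply continuous_const)
        ((π.innerUnitary h).continuous.comp (hU.clm_apply continuous_const))
    | ih f =>
    have hb : Continuous fun g : G => (β h g : ℂ) := hβ.comp (Continuous.prodMk_right h)
    rw [hδ h f (CompactlySupportedContinuousMap.mulContinuous _ hb f) fun _ => rfl,
      UnitaryRep.toGroupCStar_of, UnitaryRep.toGroupCStar_of]
    have hint : Integrable (fun g => f g • π.outerUnitary g x) μ :=
      ((map_continuous f).smul (π.outerUnitary.continuous_apply x)).integrable_of_hasCompactSupport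
        (HasCompactSupport.intro f.hasCompactSupport fun g hg => by
          simp [image_eq_zero_of_notMem_tsupport hg])
    rw [← (π.innerUnitary h).integral_comp_comm hint]
    congr 1
    ext g
    change ((β h g : ℂ) * f g) • _ = _
    rw [map_smul, π.innerUnitary_outerUnitary hβ hε, smul_smul, mul_comm]
  nondegenerate := π.outerUnitary.nondegenerate_toGroupCStar

/-- Left multiplication by `ξ` is an integral of translations by `GroupCStar.of_mul`, and `π` turns
each translation of the coefficients into `W_h`. -/
theorem toHom_mulLeft_of (ξ : C_c(H, ℂ)) (k F : ConvAlg ε μ)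
    (hF : ∀ t, F t = GroupCStar.of ν ξ * k t) (x : K) :
    π.toHom F x = ∫ h, ξ h • π.innerUnitary h (π.toHom k x) ∂ν := by
  simp only [innerUnitary_apply]
  have hξ : Continuous ξ := map_continuous ξ
  have h1 := ConvAlg.map_integral_of_l1norm_bound (π.orbit x) (norm_nonneg x)
    (fun f => π.norm_apply_le f x) ν
    (fun h => ξ h • ConvAlg.mapCoeff (CrossedProduct.translate h) k) F
    (K := tsupport ξ) (D := tsupport k) ?_ ξ.hasCompactSupport k.hasCompactSupport ?_ ?_ ?_
  · refine h1.trans ?_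
    simp only [map_smul]
    rfl
  · exact (hξ.comp continuous_fst).smul (continuous_mapCoeff_translate k)
  · intro h hh t
    simp [image_eq_zero_of_notMem_tsupport hh]
  · intro h t ht
    simp [ConvAlg.mapCoeff_apply, image_eq_zero_of_notMem_tsupport ht]
  · intro t
    rw [hF, GroupCStar.of_mul]
    rfl

/-- On vectors `π(k) x` the operator is `π(F * k)`, and `F * k` is the integral over `g` of `F(g)`
times the translate of `k` by `g`. The translate contributes `U_g`, the left factor `F(g)`
contributes the integral over `H`. -/
theorem toHom_ofProd (f : C_c(H × G, ℂ)) (k : ConvAlg ε μ) (x : K) :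
    π.toHom (ConvAlg.ofProd ε μ f) (π.toHom k x)
      = ∫ g, ∫ h, f (h, g) • π.innerUnitary h (π.outerUnitary g (π.toHom k x)) ∂ν ∂μ := by
  let F := ConvAlg.ofProd ε μ f
  let Θ : G → ConvAlg ε μ := fun g => ConvAlg.of
    ⟨⟨fun t => F g * ConvAlg.translate g k t,
      continuous_const.mul (ConvAlg.translate g k).continuous⟩,
      HasCompactSupport.intro (ConvAlg.translate g k).hasCompactSupport fun t ht => by
        simp [image_eq_zero_of_notMem_tsupport ht]⟩
  have h1 := ConvAlg.map_integral_of_l1norm_bound (π.orbit x) (norm_nonneg x)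
    (fun f => π.norm_apply_le f x) μ Θ (F * k)
    (K := tsupport F) (D := tsupport F * tsupport k) ?_ F.hasCompactSupport
    (IsCompact.mul F.hasCompactSupport k.hasCompactSupport) ?_ ?_ ?_
  · have h2 : π.toHom F (π.toHom k x) = π.toHom (F * k) x := by rw [map_mul]; rfl
    refine h2.trans (h1.trans ?_)
    congr 1
    ext g
    rw [outerUnitary_apply]
    exact π.toHom_mulLeft_of (sliceLeft f g) (ConvAlg.translate g k) (Θ g) (fun _ => rfl) x
  · exact (F.continuous.comp continuous_fst).mul (ConvAlg.continuous_translate_apply k)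
  · intro g hg t
    change F g * _ = 0
    rw [image_eq_zero_of_notMem_tsupport hg, zero_mul]
  · intro g t ht
    change F g * ε g (k (g⁻¹ * t)) = 0
    by_cases hg : g ∈ tsupport F
    · have : g⁻¹ * t ∉ tsupport k := fun h => ht ⟨g, hg, _, h, by simp⟩
      rw [image_eq_zero_of_notMem_tsupport this, map_zero, mul_zero]
    · rw [image_eq_zero_of_notMem_tsupport hg, zero_mul]
  · intro t
    rfl

/-- Both sides are double integrals over the same Weyl pair; after Fubini, the phase `β(h, g)` from
reordering the unitaries cancels the factor `β(h, g⁻¹)` of the twist. -/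
theorem dual_toHom_ofProd (hβ : Continuous fun p : H × G => (β p.1 p.2 : ℂ))
    (hδ : δ.ActsBy β) (hε : ε.ActsBy (dualPairing β))
    (f : C_c(G × H, ℂ)) (f' : C_c(H × G, ℂ))
    (hf : ∀ h g, f' (h, g) = (β h g⁻¹ : ℂ) * f (g, h)) :
    ((π.dualCovariantRep hβ hδ hε).toL1Rep ν).toHom (ConvAlg.ofProd δ ν f)
      = π.toHom (ConvAlg.ofProd ε μ f') := by
  refine π.clm_ext fun k x => ?_
  rw [toHom_ofProd, CovariantRep.toL1Rep_apply]
  generalize π.toHom k x = z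
  have h1 : ∀ h, (π.dualCovariantRep hβ hδ hε).rep (ConvAlg.ofProd δ ν f h)
      ((π.dualCovariantRep hβ hδ hε).unitary h z)
      = ∫ g, f (g, h) • π.outerUnitary g (π.innerUnitary h z) ∂μ := fun h =>
    π.outerUnitary.toGroupCStar_of _ _
  simp only [h1]
  have hc : Continuous f := map_continuous f
  rw [integral_integral_swap_of_hasCompactSupport
    (f := fun h g => f (g, h) • π.outerUnitary g (π.innerUnitary h z))]
  · congr 1
    ext g
    congr 1
    ext h
    rw [π.innerUnitary_outerUnitary hβ hε, smul_smul, hf, mul_right_comm, ← Circle.coe_mul,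
      ← map_mul, inv_mul_cancel, map_one, Circle.coe_one, one_mul]
  · exact (hc.comp (continuous_snd.prodMk continuous_fst)).smul
      (π.outerUnitary.continuous_comp continuous_snd
        ((π.innerUnitary.continuous_apply z).comp continuous_fst))
  · refine HasCompactSupport.intro (f.hasCompactSupport.isCompact.image continuous_swap) ?_
    rintro ⟨h, g⟩ hhg
    have : (g, h) ∉ tsupport f := fun hm => hhg ⟨(g, h), hm, rfl⟩
    simp [Function.uncurry, image_eq_zero_of_notMem_tsupport this]

end L1Rep

/-- Each operator entering the supremum on the left is also the image of `f` under a representation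
entering the supremum on the right. -/
theorem norm_ofProd_le (hβ : Continuous fun p : H × G => (β p.1 p.2 : ℂ))
    (hδ : δ.ActsBy β) (hε : ε.ActsBy (dualPairing β)) (f : C_c(G × H, ℂ)) (f' : C_c(H × G, ℂ))
    (hf : ∀ h g, f' (h, g) = (β h g⁻¹ : ℂ) * f (g, h)) :
    ‖CrossedProduct.ofProd ε μ f'‖ ≤ ‖CrossedProduct.ofProd δ ν f‖ := by
  rw [CrossedProduct.ofProd_eq_incl, CrossedProduct.ofProd_eq_incl, norm_incl, norm_incl]
  refine ConvAlg.univNorm_le_of_rep (norm_nonneg _) fun K _ _ _ π => ?_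
  rw [← π.dual_toHom_ofProd hβ hδ hε f f' hf]
  exact ConvAlg.rep_le_univNorm _ _

end Duality

end
-- Elementary tensors and density of two-variable functions.
noncomputable section

open scoped Pointwise

open CStarCompletion

namespace ConvAlg

variable {G : Type u} {A : Type v} [CommGroup G] [TopologicalSpace G] [IsTopologicalGroup G]
  [LocallyCompactSpace G] [MeasurableSpace G] [BorelSpace G] [NonUnitalCStarAlgebra A]
  {α : CStarAction G A} {μ : Measure G} [μ.IsHaarMeasure]

/-- The elementary tensor `t ↦ b(t) a`. -/
def tensor (b : C_c(G, ℂ)) (a : A) : ConvAlg α μ :=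
  of ⟨⟨fun t => b t • a, (map_continuous b).smul continuous_const⟩,
    HasCompactSupport.intro b.hasCompactSupport fun t ht => by
      simp [image_eq_zero_of_notMem_tsupport ht]⟩

theorem tensor_apply (b : C_c(G, ℂ)) (a : A) (t : G) : (tensor b a : ConvAlg α μ) t = b t • a := rfl

/-- The untwisted translate `t ↦ f(s t)`. -/
def shift (s : G) (f : ConvAlg α μ) : ConvAlg α μ :=
  of ⟨⟨fun t => f (s * t), f.continuous.comp (continuous_const_mul s)⟩,
    HasCompactSupport.intro (f.hasCompactSupport.isCompact.image (continuous_const_mul s⁻¹))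
      fun t ht => image_eq_zero_of_notMem_tsupport (f := f) fun h => ht ⟨s * t, h, by simp⟩⟩

theorem shift_apply (s : G) (f : ConvAlg α μ) (t : G) : shift s f t = f (s * t) := rfl

theorem shift_one (f : ConvAlg α μ) : shift 1 f = f := by
  ext t; rw [shift_apply, one_mul]

theorem continuous_shift_apply (f : ConvAlg α μ) :
    Continuous fun p : G × G => shift p.1 f p.2 :=
  f.continuous.comp continuous_mul

theorem shift_apply_eq_zero (f : ConvAlg α μ) {N : Set G} {s t : G} (hs : s ∈ N)
    (ht : t ∉ N⁻¹ * tsupport f) : shift s f t = 0 :=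
  image_eq_zero_of_notMem_tsupport (f := f) fun h =>
    ht ⟨s⁻¹, Set.inv_mem_inv.2 hs, s * t, h, by simp⟩

/-- The untwisted convolution `t ↦ ∫ b(s) f(s t) ds`. -/
def smear (b : C_c(G, ℂ)) (f : ConvAlg α μ) : ConvAlg α μ :=
  of ⟨⟨fun t => ∫ s, b s • f (s * t) ∂μ, by
    rw [← continuousOn_univ]
    refine continuousOn_integral_of_compact_support (k := tsupport b) b.hasCompactSupport ?_ ?_
    · exact (((map_continuous b).comp continuous_snd).smul (f.continuous.comp
        (continuous_snd.mul continuous_fst))).continuousOn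
    · intro t s _ hs
      rw [image_eq_zero_of_notMem_tsupport hs, zero_smul]⟩,
    HasCompactSupport.intro ((IsCompact.inv b.hasCompactSupport).mul f.hasCompactSupport)
      fun t ht => by
        refine integral_eq_zero_of_ae (Filter.Eventually.of_forall fun s => ?_)
        by_cases hs : s ∈ tsupport b
        · have := shift_apply_eq_zero f hs ht
          rw [shift_apply] at this
          simp [this]
        · simp [image_eq_zero_of_notMem_tsupport hs]⟩

theorem smear_apply (b : C_c(G, ℂ)) (f : ConvAlg α μ) (t : G) :
    smear b f t = ∫ s, b s • f (s * t) ∂μ := rfl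

/-- An `L¹`-bounded linear map which vanishes on the elementary tensors is zero. -/
theorem eq_zero_of_tensor {X : Type*} [NormedAddCommGroup X] [NormedSpace ℂ X] [CompleteSpace X]
    (T : ConvAlg α μ →ₗ[ℂ] X) {C : ℝ} (hC : 0 ≤ C) (hT : ∀ f, ‖T f‖ ≤ C * f.l1norm)
    (h0 : ∀ b a, T (tensor b a) = 0) (f : ConvAlg α μ) : T f = 0 := by
  -- It suffices that `s ↦ T (shift s f)` integrates to zero against every `b`: then it vanishes at
  -- `s = 1`. The integral is `T (smear b f)`, and the smeared function is also an integral of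
  -- elementary tensors.
  have hk : Continuous fun s => T (shift s f) := by
    refine continuous_of_l1norm_bound T hT _ (continuous_shift_apply f) fun s => ?_
    obtain ⟨N, hN, hNs⟩ := exists_compact_mem_nhds s
    exact ⟨N, hNs, N⁻¹ * tsupport f, hN.inv.mul f.hasCompactSupport,
      fun r hr t ht => shift_apply_eq_zero f hr ht⟩
  have key := eq_zero_of_forall_integral_smul_eq_zero μ hk ?_ 1
  · rwa [shift_one] at key
  intro b
  have hb : Continuous b := map_continuous b
  have h1 := map_integral_of_l1norm_bound T hC hT μ (fun s => b s • shift s f) (smear b f)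
    (K := tsupport b) (D := (tsupport b)⁻¹ * tsupport f)
    ((hb.comp continuous_fst).smul (continuous_shift_apply f)) b.hasCompactSupport
    ((IsCompact.inv b.hasCompactSupport).mul f.hasCompactSupport)
    (fun s hs t => by simp [image_eq_zero_of_notMem_tsupport hs])
    (fun s t ht => by
      by_cases hs : s ∈ tsupport b
      · simp [shift_apply_eq_zero f hs ht]
      · simp [image_eq_zero_of_notMem_tsupport hs])
    (fun t => rfl)
  simp only [map_smul] at h1
  rw [← h1]
  -- Substituting `r = s t` in `∫ b(s) f(s t) ds` gives `∫ b(r t⁻¹) f(r) dr`, whose integrand is,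
  -- for fixed `r`, an elementary tensor in `t`.
  let c : G → C_c(G, ℂ) := fun r => ⟨⟨fun t => b (r * t⁻¹), by fun_prop⟩,
    HasCompactSupport.intro ((IsCompact.inv b.hasCompactSupport).mul (isCompact_singleton (x := r)))
      fun t ht => image_eq_zero_of_notMem_tsupport (f := b) fun h =>
        ht ⟨t * r⁻¹, by simpa using h, r, rfl, by simp⟩⟩
  have hc : ∀ r t, c r t = b (r * t⁻¹) := fun _ _ => rfl
  have h2 := map_integral_of_l1norm_bound T hC hT μ (fun r => tensor (c r) (f r)) (smear b f)
    (K := tsupport f) (D := (tsupport b)⁻¹ * tsupport f)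
    ((hb.comp (continuous_fst.mul continuous_snd.inv)).smul (f.continuous.comp continuous_fst))
    f.hasCompactSupport ((IsCompact.inv b.hasCompactSupport).mul f.hasCompactSupport)
    (fun r hr t => by simp [tensor_apply, image_eq_zero_of_notMem_tsupport hr])
    (fun r t ht => by
      rw [tensor_apply, hc]
      by_cases hr : r ∈ tsupport f
      · have : r * t⁻¹ ∉ tsupport b := fun h => ht ⟨t * r⁻¹, by simpa using h, r, hr, by simp⟩
        rw [image_eq_zero_of_notMem_tsupport this, zero_smul]
      · rw [image_eq_zero_of_notMem_tsupport hr, smul_zero])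
    (fun t => by
      rw [smear_apply, ← integral_mul_right_eq_self _ t⁻¹]
      simp [tensor_apply, hc])
  rw [h2]
  simp [h0]

end ConvAlg

section Density

variable {G H : Type u} [CommGroup G] [TopologicalSpace G] [IsTopologicalGroup G]
  [LocallyCompactSpace G] [MeasurableSpace G] [BorelSpace G] {μ : Measure G} [μ.IsHaarMeasure]
  [CommGroup H] [TopologicalSpace H] [IsTopologicalGroup H]
  [LocallyCompactSpace H] [MeasurableSpace H] [BorelSpace H] {ν : Measure H} [ν.IsHaarMeasure]

variable (ν) in
/-- The canonical map `C_c(G × H) → C⋆(G) ⋊ H`, as a linear map. -/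
def CrossedProduct.ofProdₗ (δ : CStarAction H (GroupCStar μ)) :
    C_c(G × H, ℂ) →ₗ[ℂ] CrossedProduct δ ν where
  toFun := CrossedProduct.ofProd δ ν
  map_add' f g := by
    rw [CrossedProduct.ofProd_eq_incl, CrossedProduct.ofProd_eq_incl,
      CrossedProduct.ofProd_eq_incl, ← incl_add]
    congr 1
    ext h
    exact incl_add (E := ConvAlg (CStarAction.trivial G ℂ) μ) (ConvAlg.of (sliceLeft f h))
      (ConvAlg.of (sliceLeft g h))
  map_smul' c f := by
    rw [RingHom.id_apply, CrossedProduct.ofProd_eq_incl, CrossedProduct.ofProd_eq_incl,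
      ← incl_smul]
    congr 1
    ext h
    exact incl_smul (E := ConvAlg (CStarAction.trivial G ℂ) μ) c (ConvAlg.of (sliceLeft f h))

/-- Modulo the closure of the range, the inclusion is an `L¹`-bounded map. It kills `b ⊗ f` for `f`
in `C_c(G)`, hence all elementary tensors by continuity, hence everything by
`ConvAlg.eq_zero_of_tensor`. -/
theorem CrossedProduct.denseRange_ofProd (δ : CStarAction H (GroupCStar μ)) :
    DenseRange (CrossedProduct.ofProdₗ ν δ) := by
  let M := (LinearMap.range (CrossedProduct.ofProdₗ ν δ)).topologicalClosure
  have hM : IsClosed (M : Set (CrossedProduct δ ν)) := Submodule.isClosed_topologicalClosure _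
  let T : ConvAlg δ ν →ₗ[ℂ] CrossedProduct δ ν ⧸ M := M.mkQ.comp inclₗ
  have hT : ∀ f, ‖T f‖ ≤ 1 * f.l1norm := fun f =>
    (Submodule.Quotient.norm_mk_le M _).trans (CrossedProduct.norm_inclₗ_le f)
  have h0 : ∀ b a, T (ConvAlg.tensor b a) = 0 := fun b a => by
    have hb : Continuous b := map_continuous b
    induction a using GroupCStar.induction_on with
    | hp =>
      refine isClosed_eq (ConvAlg.continuous_of_l1norm_bound T hT _ ?_ fun a => ?_)
        continuous_const
      · exact (hb.comp continuous_snd).smul continuous_fst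
      · refine ⟨Set.univ, Filter.univ_mem, tsupport b, b.hasCompactSupport, fun a _ t ht => ?_⟩
        rw [ConvAlg.tensor_apply, image_eq_zero_of_notMem_tsupport ht, zero_smul]
    | ih f =>
    have hf : Continuous f := map_continuous f
    let k : C_c(G × H, ℂ) := ⟨⟨fun p => b p.2 * f p.1, by fun_prop⟩,
      HasCompactSupport.intro (f.hasCompactSupport.isCompact.prod b.hasCompactSupport)
        fun p hp => by
          by_cases h1 : p.1 ∈ tsupport f
          · have h2 : p.2 ∉ tsupport b := fun h2 => hp ⟨h1, h2⟩
            simp [image_eq_zero_of_notMem_tsupport h2]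
          · simp [image_eq_zero_of_notMem_tsupport h1]⟩
    have hk : (ConvAlg.tensor b (GroupCStar.of μ f) : ConvAlg δ ν) = ConvAlg.ofProd δ ν k := by
      ext h
      rw [ConvAlg.tensor_apply, ConvAlg.ofProd_apply]
      unfold GroupCStar.of
      rw [← incl_smul]
      congr 1
    rw [hk]
    refine (Submodule.Quotient.mk_eq_zero M).2 ?_
    exact Submodule.le_topologicalClosure _ ⟨k, rfl⟩
  have hmem : ∀ f : ConvAlg δ ν, incl f ∈ M := fun f =>
    (Submodule.Quotient.mk_eq_zero M).1 (ConvAlg.eq_zero_of_tensor T zero_le_one hT h0 f)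
  have hall : ∀ a : CrossedProduct δ ν, a ∈ M := fun a =>
    CStarCompletion.induction_on a hM hmem
  exact fun a => hall a

end Density

/-! ### Joint continuity of the pairing. -/

section JointContinuity

variable {G H : Type u} [CommGroup G] [TopologicalSpace G] [IsTopologicalGroup G]
  [LocallyCompactSpace G] [MeasurableSpace G] [BorelSpace G] {μ : Measure G} [μ.IsHaarMeasure]
  [μ.Regular] [CommGroup H] [TopologicalSpace H]

/-- If pointwise multiplication by characters defines a strongly continuous action on `C⋆(G)`, then
the evaluation pairing is jointly continuous. -/
theorem continuous_pairing (β : H →* G →* Circle) (hβ : ∀ h, Continuous fun g => (β h g : ℂ))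
    (δ : CStarAction H (GroupCStar μ)) (hδ : δ.ActsBy β) :
    Continuous fun p : H × G => (β p.1 p.2 : ℂ) := by
  -- The trivial representation on a one-dimensional space in the right universe yields a continuous
  -- functional `c` on `C⋆(G)` extending `f ↦ ∫ f`.
  let K := EuclideanSpace ℂ PUnit.{u + 1}
  let x : K := WithLp.toLp 2 fun _ => 1
  let L : K →L[ℂ] ℂ := EuclideanSpace.proj PUnit.unit
  let U := (UnitaryRep.trivial G K).toGroupCStar μ
  let c : GroupCStar μ → ℂ := fun a => L (U a x)
  have hc : Continuous c := L.continuous.comp (U.continuous_of_cstar.clm_apply continuous_const)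
  have hcf : ∀ f : C_c(G, ℂ), c (GroupCStar.of μ f) = ∫ g, f g ∂μ := fun f => by
    change L (U (GroupCStar.of μ f) x) = _
    rw [UnitaryRep.toGroupCStar_of]
    simp only [UnitaryRep.trivial_apply]
    rw [integral_smul_const, map_smul]
    exact mul_one _
  let I : H → C_c(G, ℂ) → ℂ := fun h f => ∫ g, (β h g : ℂ) * f g ∂μ
  have hcδ : ∀ h f, c (δ h (GroupCStar.of μ f)) = I h f := fun h f => by
    rw [hδ h f (CompactlySupportedContinuousMap.mulContinuous _ (hβ h) f) fun _ => rfl, hcf]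
    rfl
  -- Translating `f` by `g` pulls the scalar `β(h, g)` out of the integral, so `β` is a quotient of
  -- two functions that are continuous by strong continuity of `δ` and of translation.
  have hshift : ∀ h g f, c (δ h (CrossedProduct.translate g (GroupCStar.of μ f)))
      = (β h g : ℂ) * I h f := fun h g f => by
    let f' : C_c(G, ℂ) :=
      ConvAlg.translate (α := CStarAction.trivial G ℂ) (μ := μ) g (ConvAlg.of f)
    have h1 : CrossedProduct.translate g (GroupCStar.of μ f) = GroupCStar.of μ f' :=
      CrossedProduct.translate_incl g _
    rw [h1, hcδ]
    change ∫ t, (β h t : ℂ) * f (g⁻¹ * t) ∂μ = _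
    rw [← integral_mul_left_eq_self _ g, ← integral_const_mul]
    congr 1
    ext t
    simp [mul_assoc]
  rw [continuous_iff_continuousAt]
  rintro ⟨h₀, g₀⟩
  -- Otherwise the character at `h₀` would vanish at `1`, where its value is `1`.
  obtain ⟨f, hf⟩ : ∃ f, I h₀ f ≠ 0 := by
    by_contra! hI
    have := eq_zero_of_forall_integral_smul_eq_zero μ (hβ h₀)
      (fun b => by simpa only [I, smul_eq_mul, mul_comm] using hI b) 1
    simp at this
  have hnum : Continuous fun p : H × G =>
      c (δ p.1 (CrossedProduct.translate p.2 (GroupCStar.of μ f))) :=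
    hc.comp (δ.continuous_comp continuous_fst
      (CrossedProduct.continuous_translate_comp continuous_snd continuous_const))
  have hden : Continuous fun p : H × G => I p.1 f := by
    simp only [← hcδ]
    exact hc.comp (δ.continuous_comp continuous_fst continuous_const)
  have hquot := (hnum.continuousAt (x := (h₀, g₀))).div (hden.continuousAt (x := (h₀, g₀))) hf
  refine hquot.congr ?_
  filter_upwards [hden.continuousAt.eventually_ne hf] with p hp
  rw [Pi.div_apply, hshift, mul_div_cancel_right₀ _ hp]

end JointContinuity

/-! ### The twist and the isomorphism of crossed products. -/

section Iso

variable {G H : Type u} [CommGroup G] [TopologicalSpace G] [IsTopologicalGroup G]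
  [LocallyCompactSpace G] [MeasurableSpace G] [BorelSpace G] {μ : Measure G} [μ.IsHaarMeasure]
  [μ.Regular]
  [CommGroup H] [TopologicalSpace H] [IsTopologicalGroup H]
  [LocallyCompactSpace H] [MeasurableSpace H] [BorelSpace H] {ν : Measure H} [ν.IsHaarMeasure]
  [ν.Regular]

/-- The map `f ↦ [(h, g) ↦ β(h, g⁻¹) f(g, h)]`. -/
def twist (β : H →* G →* Circle) (hβ : Continuous fun p : H × G => (β p.1 p.2 : ℂ)) :
    C_c(G × H, ℂ) →ₗ[ℂ] C_c(H × G, ℂ) where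
  toFun f := ⟨⟨fun p => (β p.1 p.2⁻¹ : ℂ) * f (p.2, p.1),
      (hβ.comp (continuous_fst.prodMk continuous_snd.inv)).mul
        ((map_continuous f).comp (continuous_snd.prodMk continuous_fst))⟩,
    HasCompactSupport.intro (f.hasCompactSupport.isCompact.image continuous_swap) fun p hp => by
      have : (p.2, p.1) ∉ tsupport f := fun hm => hp ⟨_, hm, rfl⟩
      simp [image_eq_zero_of_notMem_tsupport this]⟩
  map_add' f g := by ext p; exact mul_add _ _ _
  map_smul' c f := by ext p; exact mul_left_comm _ _ _

theorem twist_apply (β : H →* G →* Circle) (hβ : Continuous fun p : H × G => (β p.1 p.2 : ℂ))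
    (f : C_c(G × H, ℂ)) (h : H) (g : G) :
    twist β hβ f (h, g) = (β h g⁻¹ : ℂ) * f (g, h) := rfl

/-- `twist` as a linear equivalence. -/
def twistEquiv (β : H →* G →* Circle) (hβ : Continuous fun p : H × G => (β p.1 p.2 : ℂ)) :
    C_c(G × H, ℂ) ≃ₗ[ℂ] C_c(H × G, ℂ) where
  __ := twist β hβ
  invFun := twist (dualPairing β) (continuous_dualPairing β hβ)
  left_inv f := by
    ext ⟨g, h⟩
    change (dualPairing β g h⁻¹ : ℂ) * ((β h g⁻¹ : ℂ) * f (g, h)) = f (g, h)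
    rw [dualPairing_apply, ← mul_assoc, ← Circle.coe_mul]
    simp
  right_inv f := by
    ext ⟨h, g⟩
    change (β h g⁻¹ : ℂ) * ((dualPairing β g h⁻¹ : ℂ) * f (h, g)) = f (h, g)
    rw [dualPairing_apply, ← mul_assoc, ← Circle.coe_mul]
    simp

variable {β : H →* G →* Circle} {δ : CStarAction H (GroupCStar μ)}
  {ε : CStarAction G (GroupCStar ν)}

/-- The opposite of the opposite pairing is the original one, so `norm_ofProd_le` applies in both
directions with the roles of `δ` and `ε` exchanged. -/
theorem norm_ofProd_twist (hβ : Continuous fun p : H × G => (β p.1 p.2 : ℂ))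
    (hδ : δ.ActsBy β) (hε : ε.ActsBy (dualPairing β)) (f : C_c(G × H, ℂ)) :
    ‖CrossedProduct.ofProd ε μ (twist β hβ f)‖ = ‖CrossedProduct.ofProd δ ν f‖ := by
  refine le_antisymm (norm_ofProd_le hβ hδ hε f _ fun h g => twist_apply β hβ f h g) ?_
  refine norm_ofProd_le (β := dualPairing β) (continuous_dualPairing β hβ) (δ := ε) (ε := δ)
    hε (fun h k k' hk => hδ h k k' fun g => ?_) (twist β hβ f) f
    fun g h => ?_
  · rw [hk, dualPairing_apply, dualPairing_apply]
    simp
  · rw [twist_apply, dualPairing_apply, ← mul_assoc, ← Circle.coe_mul]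
    simp

/-- The isometric extension of `twist` to the crossed products. -/
def twistIsometry
    (hβ : Continuous fun p : H × G => (β p.1 p.2 : ℂ))
    (hδ : δ.ActsBy β) (hε : ε.ActsBy (dualPairing β)) :
    CrossedProduct δ ν ≃ₗᵢ[ℂ] CrossedProduct ε μ :=
  (twistEquiv β hβ).extendOfIsometry (CrossedProduct.ofProdₗ ν δ) (CrossedProduct.ofProdₗ μ ε)
    (CrossedProduct.denseRange_ofProd δ) (CrossedProduct.denseRange_ofProd ε)
    (norm_ofProd_twist hβ hδ hε)

theorem twistIsometry_ofProd (hβ : Continuous fun p : H × G => (β p.1 p.2 : ℂ))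
    (hδ : δ.ActsBy β) (hε : ε.ActsBy (dualPairing β)) (f : C_c(G × H, ℂ)) :
    twistIsometry hβ hδ hε (CrossedProduct.ofProd δ ν f)
      = CrossedProduct.ofProd ε μ (twist β hβ f) :=
  LinearEquiv.extendOfIsometry_eq (twistEquiv β hβ) _ _ (CrossedProduct.denseRange_ofProd δ)
    (CrossedProduct.denseRange_ofProd ε) (norm_ofProd_twist hβ hδ hε) f

/-- The right side is a ⋆-homomorphism in `a`; this transfers the algebraic structure to
`twistIsometry`. The two sides agree on the dense set of two-variable functions. -/
theorem lift_twistIsometry (hβ : Continuous fun p : H × G => (β p.1 p.2 : ℂ))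
    (hδ : δ.ActsBy β) (hε : ε.ActsBy (dualPairing β))
    {K : Type u} [NormedAddCommGroup K] [InnerProductSpace ℂ K]
    [CompleteSpace K] (π : L1Rep ε μ K) (a : CrossedProduct δ ν) :
    π.lift (twistIsometry hβ hδ hε a) = ((π.dualCovariantRep hβ hδ hε).toL1Rep ν).lift a := by
  refine (CrossedProduct.denseRange_ofProd δ).induction_on a (isClosed_eq
    (π.lift.continuous_of_cstar.comp (twistIsometry hβ hδ hε).continuous)
    (NonUnitalStarAlgHom.continuous_of_cstar _)) fun f => ?_
  change π.lift (twistIsometry hβ hδ hε (CrossedProduct.ofProd δ ν f)) =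
    L1Rep.lift _ (CrossedProduct.ofProd δ ν f)
  rw [twistIsometry_ofProd, CrossedProduct.ofProd_eq_incl, CrossedProduct.ofProd_eq_incl,
    L1Rep.lift_incl, L1Rep.lift_incl]
  exact (π.dual_toHom_ofProd hβ hδ hε f _ fun h g => twist_apply β hβ f h g).symm

/-- The isomorphism of crossed products extending `twist`. -/
def crossedProductDuality (hβ : Continuous fun p : H × G => (β p.1 p.2 : ℂ))
    (hδ : δ.ActsBy β) (hε : ε.ActsBy (dualPairing β)) :
    CrossedProduct δ ν ≃⋆ₐ[ℂ] CrossedProduct ε μ where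
  toFun := twistIsometry hβ hδ hε
  invFun := (twistIsometry hβ hδ hε).symm
  left_inv := (twistIsometry hβ hδ hε).symm_apply_apply
  right_inv := (twistIsometry hβ hδ hε).apply_symm_apply
  map_add' := map_add _
  map_smul' := map_smul _
  -- Each representation of the target, composed with the isometry, is multiplicative, so it
  -- annihilates the defect; representations separate points.
  map_mul' a b := by
    rw [← sub_eq_zero]
    refine CrossedProduct.eq_zero_of_forall_lift_eq_zero _ fun K _ _ _ π => ?_
    rw [map_sub, map_mul π.lift, lift_twistIsometry, lift_twistIsometry, lift_twistIsometry,
      map_mul, sub_self]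
  map_star' a := by
    rw [← sub_eq_zero]
    refine CrossedProduct.eq_zero_of_forall_lift_eq_zero _ fun K _ _ _ π => ?_
    rw [map_sub, map_star π.lift, lift_twistIsometry, lift_twistIsometry, map_star, sub_self]

end Iso

end

theorem mainTheorem6 {G H : Type u}
    -- a locally compact (Hausdorff) abelian group `G`, written multiplicatively, with Haar measure
    [CommGroup G] [TopologicalSpace G] [IsTopologicalGroup G] [LocallyCompactSpace G] [T2Space G]
    [MeasurableSpace G] [BorelSpace G] (μ : Measure G) [μ.IsHaarMeasure] [μ.Regular]
    -- a locally compact (Hausdorff) abelian group `H`, with Haar measure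
    [CommGroup H] [TopologicalSpace H] [IsTopologicalGroup H] [LocallyCompactSpace H] [T2Space H]
    [MeasurableSpace H] [BorelSpace H] (ν : Measure H) [ν.IsHaarMeasure] [ν.Regular]
    -- `H` is, algebraically, a subgroup of the dual group (its topology is its own)
    (j : H →* PontryaginDual G) (_hj : Function.Injective j)
    -- `δ_h(f) = [g ↦ h(g) f(g)]` extends to a strongly continuous action of `H` on `C⋆(G)`
    (δ : CStarAction H (GroupCStar μ))
    (_hδ : ∀ (h : H) (f : C_c(G, ℂ)), ∃ f' : C_c(G, ℂ),
      (∀ g, f' g = (j h g : ℂ) * f g) ∧ δ h (GroupCStar.of μ f) = GroupCStar.of μ f')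
    -- `ε_g(f) = [h ↦ h(g⁻¹) f(h)]` extends to a strongly continuous action of `G` on `C⋆(H)`
    (ε : CStarAction G (GroupCStar ν))
    (_hε : ∀ (g : G) (f : C_c(H, ℂ)), ∃ f' : C_c(H, ℂ),
      (∀ h, f' h = (j h g⁻¹ : ℂ) * f h) ∧ ε g (GroupCStar.of ν f) = GroupCStar.of ν f') :
    ∃ φ : C_c(G × H, ℂ) → C_c(H × G, ℂ),
      (∀ f h g, φ f (h, g) = (j h g⁻¹ : ℂ) * f (g, h)) ∧
      ∃ Φ : CrossedProduct δ ν ≃⋆ₐ[ℂ] CrossedProduct ε μ,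
        ∀ f, Φ (CrossedProduct.ofProd δ ν f) = CrossedProduct.ofProd ε μ (φ f) := by
  let β : H →* G →* Circle :=
    { toFun h := (j h).toMonoidHom
      map_one' := by rw [map_one]; rfl
      map_mul' h k := by rw [map_mul]; rfl }
  -- The function provided by the hypothesis is determined by its values, so it is the given `f'`.
  have hδ : δ.ActsBy β := fun h f f' hf => by
    obtain ⟨k, hk, hδk⟩ := _hδ h f
    have : k = f' := by ext g; rw [hk, hf]; rfl
    rw [hδk, this]
  have hε : ε.ActsBy (dualPairing β) := fun g f f' hf => by
    obtain ⟨k, hk, hεk⟩ := _hε g f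
    have : k = f' := by ext h; rw [hk, hf]; rfl
    rw [hεk, this]
  have hβ := continuous_pairing β
    (fun h => continuous_subtype_val.comp (j h).continuous_toFun) δ hδ
  exact ⟨twist β hβ, twist_apply β hβ, crossedProductDuality hβ hδ hε,
    twistIsometry_ofProd hβ hδ hε⟩
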